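/- Let $m\ge 0$. For $d\in\mathbb Z$ let $e_d(\vec x)$ be the elementary symmetric function in $\vec x=(x_1,x_2,\dots)$ ($e_0=1$, $e_d=0$ for $d<0$). For a skew shape $\lambda/\mu$ put $$\mathrm{JT}_{\lambda/\mu}(\vec x)=\bigl(e_{\lambda_i-\mu_j-i+j}(\vec x)\bigr)_{i,j=1}^{\ell(\lambda)},\qquad s_{\lambda/\mu}(\vec x)=\det \mathrm{JT}_{\lambda'/\mu'}(\vec x),$$ where $'$ denotes conjugation; in particular $\mathrm{JT}_{(1^m)}(\vec x)=(e_{1-i+j}(\vec x))_{i,j=1}^m$. A ribbon is a skew shape $\lambda/\mu$ that is connected (any two cells are joined by a path of cells in which consecutive cells share an edge) and contains no $2\times2$ block of cells; $\mathcal R_m$ denotes the set of ribbons $\lambda/\mu$ with $m$ cells such that $\{i:\lambda_i>\mu_i\}=\{1,\dots,\ell(\lambda)\}$. Let $TL_m(2)$ be the $\mathbb C$-algebra with generators $t_1,\dots,t_{m-1}$ and relations $t_i^2=2t_i$, $t_it_jt_i=t_i$ if $|i-j|=1$, and $t_it_j=t_jt_i$ if $|i-j|\ge2$; it has the basis $\mathcal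 B_m$ of Kauffman diagrams (noncrossing perfect matchings of $m$ points on the left and $m$ points on the right side of a rectangle; products are concatenations, each closed loop being replaced by a factor $2$). Let $\theta:\mathbb C[\mathfrak S_m]\to TL_m(2)$ be the algebra homomorphism with $\theta((i,i+1))=t_i-1$, where permutations are composed from left to right. For $\tau\in\mathcal B_m$ let $f_\tau(w)$ be the coefficient of $\tau$ in $\theta(w)$; the Temperley–Lieb immanant of an $m\times m$ matrix $M$ is $$\mathrm{imm}_\tau(M)=\sum_{w\in\mathfrak S_m}f_\tau(w)\,M_{1,w(1)}\cdots M_{m,w(m)}.$$ Then: 1. for every ribbon $R\in\mathcal R_m$ there is $\tau\in\mathcal B_m$ with $s_R(\vec x)=\mathrm{imm}_\tau(\mathrm{JT}_{(1^m)}(\vec x))$; 2. conversely, for every $\tau\in\mathcal B_m$ with $\mathrm{imm}_\tau(\mathrm{JT}_{(1^m)}(\vec x))\ne0$ there is $R=\lambda/\mu\in\mathcal R_m$ with $\mathrm{imm}_\tau(\mathrm{JT}_{(1^m)}(\vec x))=s_R(\vec x)$; moreover $R$ can be chosen without empty columns, i.e. with $\{j:\lambda'_j>\mu'_j\}=\{1,\dots,\ell(\lambda')\}$.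 -/

import Mathlib

namespace TLImm

section Presentation

variable {G : Type*} [Monoid G]

/-- `ascWord h k r = h k * h (k+1) * ... * h (k+r-1)`. -/
def ascWord (h : ℕ → G) (k : ℕ) : ℕ → G
  | 0 => 1
  | r + 1 => ascWord h k r * h (k + r)

theorem ascWord_succ' (h : ℕ → G) (k r : ℕ) :
    ascWord h k (r + 1) = h k * ascWord h (k + 1) r := by
  induction r with
  | zero => simp [ascWord]
  | succ r ih =>
    rw [ascWord, ih, ascWord, mul_assoc, show k + (r + 1) = k + 1 + r by omega]

theorem ascWord_comm (h : ℕ → G) (N : ℕ)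
    (hc : ∀ i j, i < N → j < N → i + 2 ≤ j → h i * h j = h j * h i)
    (i k r : ℕ) (hik : i + 2 ≤ k) (hr : k + r ≤ N) :
    h i * ascWord h k r = ascWord h k r * h i := by
  induction r with
  | zero => simp [ascWord]
  | succ r ih =>
    rw [ascWord, ← mul_assoc, ih (by omega), mul_assoc, mul_assoc,
      hc i (k + r) (by omega) (by omega) (by omega)]

theorem ascWord_shift (h : ℕ → G) (N : ℕ)
    (hb : ∀ i, i + 1 < N → h (i + 1) * h i * h (i + 1) = h i * h (i + 1) * h i)
    (hc : ∀ i j, i < N → j < N → i + 2 ≤ j → h i * h j = h j * h i)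
    (i k r : ℕ) (hik : k ≤ i) (hir : i + 1 < k + r) (hr : k + r ≤ N) :
    h (i + 1) * ascWord h k r = ascWord h k r * h i := by
  induction r generalizing k with
  | zero => omega
  | succ r ih =>
    rw [ascWord_succ']
    rcases Nat.lt_or_ge k i with hlt | hge
    · rw [← mul_assoc, ← hc k (i + 1) (by omega) (by omega) (by omega), mul_assoc,
        ih (k + 1) (by omega) (by omega) (by omega), mul_assoc]
    · obtain rfl : k = i := by omega
      obtain ⟨r, rfl⟩ : ∃ r', r = r' + 1 := ⟨r - 1, by omega⟩
      rw [ascWord_succ', mul_assoc, mul_assoc,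
        ← ascWord_comm h N hc k (k + 1 + 1) r (by omega) (by omega)]
      simp only [← mul_assoc]
      rw [hb k (by omega)]

theorem exists_normalForm (h : ℕ → G) (n : ℕ)
    (hs : ∀ i, i < n + 1 → h i * h i = 1)
    (hb : ∀ i, i + 1 < n + 1 → h (i + 1) * h i * h (i + 1) = h i * h (i + 1) * h i)
    (hc : ∀ i j, i < n + 1 → j < n + 1 → i + 2 ≤ j → h i * h j = h j * h i)
    (x : G) (hx : x ∈ Submonoid.closure (h '' {i | i < n + 1})) :
    ∃ k r, k + r = n + 1 ∧ ∃ y ∈ Submonoid.closure (h '' {i | i < n}),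
      x = ascWord h k r * y := by
  induction hx using Submonoid.closure_induction_left with
  | one => exact ⟨n + 1, 0, by omega, 1, Submonoid.one_mem _, by simp [ascWord]⟩
  | mul_left a ha b hb' ih =>
    obtain ⟨i, hi, rfl⟩ := ha
    obtain ⟨k, r, hkr, y, hy, rfl⟩ := ih
    have hi' : i < n + 1 := hi
    have hmem : ∀ j, j < n → h j * y ∈ Submonoid.closure (h '' {i | i < n}) := fun j hj =>
      Submonoid.mul_mem _ (Submonoid.subset_closure ⟨j, hj, rfl⟩) hy
    rcases Nat.lt_or_ge (i + 1) k with h1 | h1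
    · exact ⟨k, r, hkr, h i * y, hmem i (by omega), by
        rw [← mul_assoc, ascWord_comm h (n + 1) hc i k r (by omega) (by omega), mul_assoc]⟩
    rcases Nat.lt_or_ge i k with h2 | h2
    · obtain rfl : k = i + 1 := by omega
      exact ⟨i, r + 1, by omega, y, hy, by rw [ascWord_succ', mul_assoc]⟩
    rcases Nat.lt_or_ge k i with h3 | h3
    · obtain ⟨j, rfl⟩ : ∃ j, i = j + 1 := ⟨i - 1, by omega⟩
      exact ⟨k, r, hkr, h j * y, hmem j (by omega), by
        rw [← mul_assoc, ascWord_shift h (n + 1) hb hc j k r (by omega) (by omega) (by omega),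
          mul_assoc]⟩
    · obtain rfl : k = i := by omega
      obtain ⟨r, rfl⟩ : ∃ r', r = r' + 1 := ⟨r - 1, by omega⟩
      exact ⟨k + 1, r, by omega, y, hy, by
        rw [ascWord_succ', ← mul_assoc, ← mul_assoc, hs k hi', one_mul]⟩

end Presentation

/-- The simple transposition exchanging the `i`-th and `(i+1)`-st letter
(letters and transpositions are counted from `0`). -/
def simpleSwap (n : ℕ) (i : Fin (n - 1)) : Equiv.Perm (Fin n) :=
  Equiv.swap ⟨i, by omega⟩ ⟨i + 1, by omega⟩

section Lift

variable {M : Type*} [Monoid M] {n : ℕ} (g : Fin (n - 1) → M)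

/-- The pairs `(s_i, g_i)`, continued by `1`. -/
def pairGen (i : ℕ) : Equiv.Perm (Fin n) × M :=
  if hi : i < n - 1 then (simpleSwap n ⟨i, hi⟩, g ⟨i, hi⟩) else 1

theorem simpleSwap_sq (i : Fin (n - 1)) : simpleSwap n i * simpleSwap n i = 1 := by
  simp [simpleSwap]

theorem simpleSwap_braid (i j : Fin (n - 1)) (hij : (j : ℕ) = i + 1) :
    simpleSwap n j * simpleSwap n i * simpleSwap n j =
      simpleSwap n i * simpleSwap n j * simpleSwap n i := by
  ext x
  simp only [simpleSwap, Equiv.Perm.mul_apply, Equiv.swap_apply_def]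
  grind

theorem simpleSwap_comm (i j : Fin (n - 1)) (hij : (i : ℕ) + 2 ≤ j) :
    simpleSwap n i * simpleSwap n j = simpleSwap n j * simpleSwap n i := by
  ext x
  simp only [simpleSwap, Equiv.Perm.mul_apply, Equiv.swap_apply_def]
  grind

theorem simpleSwap_closure (n : ℕ) :
    Submonoid.closure (Set.range (simpleSwap n)) = ⊤ := by
  rcases n with _ | n
  · rw [eq_top_iff]; intro x _
    rw [Subsingleton.elim x 1]; exact Submonoid.one_mem _
  · rw [← Equiv.Perm.mclosure_swap_castSucc_succ n]
    rfl

theorem pairGen_sq (hsq : ∀ i, g i * g i = 1) (i : ℕ) : pairGen g i * pairGen g i = 1 := by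
  unfold pairGen
  split_ifs with hi
  · simp [hsq, simpleSwap_sq]
  · simp

theorem pairGen_braid
    (hbr : ∀ i j : Fin (n - 1), (j : ℕ) = i + 1 → g j * g i * g j = g i * g j * g i)
    (i : ℕ) (hi : i + 1 < n - 1) :
    pairGen g (i + 1) * pairGen g i * pairGen g (i + 1) =
      pairGen g i * pairGen g (i + 1) * pairGen g i := by
  have hi' : i < n - 1 := by omega
  simp only [pairGen, hi, hi', dif_pos, Prod.mk_mul_mk]
  rw [hbr ⟨i, hi'⟩ ⟨i + 1, hi⟩ rfl, simpleSwap_braid ⟨i, hi'⟩ ⟨i + 1, hi⟩ rfl]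

theorem pairGen_comm
    (hco : ∀ i j : Fin (n - 1), (i : ℕ) + 2 ≤ j → g i * g j = g j * g i)
    (i j : ℕ) (hi : i < n - 1) (hj : j < n - 1) (hij : i + 2 ≤ j) :
    pairGen g i * pairGen g j = pairGen g j * pairGen g i := by
  simp only [pairGen, hi, hj, dif_pos, Prod.mk_mul_mk]
  rw [hco ⟨i, hi⟩ ⟨j, hj⟩ hij, simpleSwap_comm ⟨i, hi⟩ ⟨j, hj⟩ hij]

theorem ascWord_pairGen_apply (k r : ℕ) (hkr : k + r < n) :
    (((ascWord (pairGen g) k r).1 ⟨k + r, hkr⟩ : Fin n) : ℕ) = k := by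
  induction r with
  | zero => simp [ascWord]
  | succ r ih =>
    have h1 : k + r < n - 1 := by omega
    rw [ascWord, Prod.fst_mul, Equiv.Perm.mul_apply]
    have : (pairGen g (k + r)).1 ⟨k + (r + 1), hkr⟩ = ⟨k + r, by omega⟩ := by
      simp only [pairGen, h1, dif_pos, simpleSwap]
      exact Equiv.swap_apply_right _ _
    rw [this, ih]

theorem closure_pairGen_fixes (N : ℕ) (_hN : N < n) (x : Equiv.Perm (Fin n) × M)
    (hx : x ∈ Submonoid.closure (pairGen g '' {i | i < N})) (p : Fin n) (hp : N < (p : ℕ)) :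
    x.1 p = p := by
  induction hx using Submonoid.closure_induction_left with
  | one => rfl
  | mul_left a ha b hb ih =>
    obtain ⟨i, hi, rfl⟩ := ha
    have hi1 : i < N := hi
    have hi2 : i < n - 1 := by omega
    rw [Prod.fst_mul, Equiv.Perm.mul_apply, ih]
    simp only [pairGen, hi2, dif_pos, simpleSwap]
    apply Equiv.swap_apply_of_ne_of_ne <;> (intro h; rw [h] at hp; simp at hp; omega)

theorem closure_pairGen_eq_one (hsq : ∀ i, g i * g i = 1)
    (hbr : ∀ i j : Fin (n - 1), (j : ℕ) = i + 1 → g j * g i * g j = g i * g j * g i)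
    (hco : ∀ i j : Fin (n - 1), (i : ℕ) + 2 ≤ j → g i * g j = g j * g i)
    (N : ℕ) (hN : N ≤ n - 1) (x : Equiv.Perm (Fin n) × M)
    (hx : x ∈ Submonoid.closure (pairGen g '' {i | i < N})) (h1 : x.1 = 1) : x = 1 := by
  induction N generalizing x with
  | zero => simpa using hx
  | succ N ih =>
    obtain ⟨k, r, hkr, y, hy, rfl⟩ := exists_normalForm (pairGen g) N
      (fun i _ => pairGen_sq g hsq i) (fun i hi => pairGen_braid g hbr i (by omega))
      (fun i j hi hj hij => pairGen_comm g hco i j (by omega) (by omega) hij) x hx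
    have hlt : k + r < n := by omega
    have h2 : (ascWord (pairGen g) k r * y).1 ⟨k + r, hlt⟩ = ⟨k + r, hlt⟩ := by
      rw [h1]; rfl
    rw [Prod.fst_mul, Equiv.Perm.mul_apply,
      closure_pairGen_fixes g N (by omega) y hy ⟨k + r, hlt⟩ (by simp; omega)] at h2
    have h3 := congrArg Fin.val h2
    rw [ascWord_pairGen_apply g k r hlt] at h3
    obtain rfl : r = 0 := by simp at h3; omega
    simp only [ascWord, one_mul] at h1 ⊢
    exact ih (by omega) y hy h1

/-- All products of the pairs `(s_i, g_i)`. -/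
def pairMonoid : Submonoid (Equiv.Perm (Fin n) × M) :=
  Submonoid.closure (pairGen g '' {i | i < n - 1})

theorem pair_mem (i : Fin (n - 1)) : (simpleSwap n i, g i) ∈ pairMonoid g :=
  Submonoid.subset_closure ⟨i, i.2, by simp [pairGen]⟩

theorem pairMonoid_bijective (hsq : ∀ i, g i * g i = 1)
    (hbr : ∀ i j : Fin (n - 1), (j : ℕ) = i + 1 → g j * g i * g j = g i * g j * g i)
    (hco : ∀ i j : Fin (n - 1), (i : ℕ) + 2 ≤ j → g i * g j = g j * g i) :
    Function.Bijective ((MonoidHom.fst (Equiv.Perm (Fin n)) M).comp (pairMonoid g).subtype) := by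
  constructor
  · have hinv : ∀ x ∈ pairMonoid g, ∃ y ∈ pairMonoid g, y * x = 1 ∧ x * y = 1 := by
      intro x hx
      induction hx using Submonoid.closure_induction_left with
      | one => exact ⟨1, Submonoid.one_mem _, by simp⟩
      | mul_left a ha b hb ih =>
        obtain ⟨y, hy, h1, h2⟩ := ih
        have ha' : a ∈ pairMonoid g := Submonoid.subset_closure ha
        obtain ⟨i, hi, rfl⟩ := ha
        refine ⟨y * pairGen g i, Submonoid.mul_mem _ hy ha', ?_, ?_⟩
        · rw [mul_assoc, ← mul_assoc (pairGen g i), pairGen_sq g hsq, one_mul, h1]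
        · rw [mul_assoc, ← mul_assoc b, h2, one_mul, pairGen_sq g hsq]
    rintro ⟨x, hx⟩ ⟨y, hy⟩ hxy
    have hxy' : x.1 = y.1 := hxy
    obtain ⟨z, hz, h1, h2⟩ := hinv x hx
    have h3 : z * y = 1 := closure_pairGen_eq_one g hsq hbr hco (n - 1) le_rfl _
      (Submonoid.mul_mem _ hz hy) (by rw [Prod.fst_mul, ← hxy', ← Prod.fst_mul, h1]; rfl)
    apply Subtype.ext
    change x = y
    rw [← mul_one x, ← h3, ← mul_assoc, h2, one_mul]
  · intro w
    have hw : w ∈ Submonoid.closure (Set.range (simpleSwap n)) := by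
      rw [simpleSwap_closure]; exact Submonoid.mem_top w
    induction hw using Submonoid.closure_induction_left with
    | one => exact ⟨1, map_one _⟩
    | mul_left a ha b hb ih =>
      obtain ⟨i, rfl⟩ := ha
      obtain ⟨z, hz⟩ := ih
      refine ⟨⟨_, pair_mem g i⟩ * z, ?_⟩
      rw [map_mul, hz]
      rfl

/-- The monoid homomorphism from the symmetric group that sends each simple transposition `s_i`
to `g i`, for elements `g i` that satisfy the Coxeter relations. -/
noncomputable def permLift (hsq : ∀ i, g i * g i = 1)
    (hbr : ∀ i j : Fin (n - 1), (j : ℕ) = i + 1 → g j * g i * g j = g i * g j * g i)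
    (hco : ∀ i j : Fin (n - 1), (i : ℕ) + 2 ≤ j → g i * g j = g j * g i) :
    Equiv.Perm (Fin n) →* M :=
  ((MonoidHom.snd (Equiv.Perm (Fin n)) M).comp (pairMonoid g).subtype).comp
    (MulEquiv.ofBijective _ (pairMonoid_bijective g hsq hbr hco)).symm.toMonoidHom

theorem permLift_simpleSwap (hsq : ∀ i, g i * g i = 1)
    (hbr : ∀ i j : Fin (n - 1), (j : ℕ) = i + 1 → g j * g i * g j = g i * g j * g i)
    (hco : ∀ i j : Fin (n - 1), (i : ℕ) + 2 ≤ j → g i * g j = g j * g i) (i : Fin (n - 1)) :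
    permLift g hsq hbr hco (simpleSwap n i) = g i := by
  have h : (MulEquiv.ofBijective _ (pairMonoid_bijective g hsq hbr hco)).symm (simpleSwap n i) =
      ⟨_, pair_mem g i⟩ := by
    rw [MulEquiv.symm_apply_eq]; rfl
  change ((MulEquiv.ofBijective _ (pairMonoid_bijective g hsq hbr hco)).symm
    (simpleSwap n i)).1.2 = g i
  rw [h]

end Lift

/-- The defining relations of the Temperley-Lieb algebra with loop value `2`. -/
inductive TLRel (n : ℕ) : FreeAlgebra ℂ (Fin (n - 1)) → FreeAlgebra ℂ (Fin (n - 1)) → Prop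
  | sq (i : Fin (n - 1)) :
      TLRel n (FreeAlgebra.ι ℂ i * FreeAlgebra.ι ℂ i) ((2 : ℂ) • FreeAlgebra.ι ℂ i)
  | braid (i j : Fin (n - 1)) (hij : (i : ℕ) + 1 = j ∨ (j : ℕ) + 1 = i) :
      TLRel n (FreeAlgebra.ι ℂ i * FreeAlgebra.ι ℂ j * FreeAlgebra.ι ℂ i) (FreeAlgebra.ι ℂ i)
  | comm (i j : Fin (n - 1)) (hij : (i : ℕ) + 2 ≤ j ∨ (j : ℕ) + 2 ≤ i) :
      TLRel n (FreeAlgebra.ι ℂ i * FreeAlgebra.ι ℂ j) (FreeAlgebra.ι ℂ j * FreeAlgebra.ι ℂ i)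

/-- The Temperley-Lieb algebra `TL_n(2)` over `ℂ`, by generators and relations. -/
abbrev TL (n : ℕ) : Type := RingQuot (TLRel n)

/-- The generator `t_i` of `TL_n(2)`. -/
noncomputable def TL.t {n : ℕ} (i : Fin (n - 1)) : TL n :=
  RingQuot.mkAlgHom ℂ (TLRel n) (FreeAlgebra.ι ℂ i)

theorem TL.t_sq {n : ℕ} (i : Fin (n - 1)) : (TL.t i * TL.t i : TL n) = (2 : ℂ) • TL.t i := by
  simpa [TL.t] using RingQuot.mkAlgHom_rel ℂ (TLRel.sq i)

theorem TL.t_braid {n : ℕ} (i j : Fin (n - 1)) (hij : (i : ℕ) + 1 = j ∨ (j : ℕ) + 1 = i) :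
    (TL.t i * TL.t j * TL.t i : TL n) = TL.t i := by
  simpa [TL.t] using RingQuot.mkAlgHom_rel ℂ (TLRel.braid i j hij)

theorem TL.t_comm {n : ℕ} (i j : Fin (n - 1)) (hij : (i : ℕ) + 2 ≤ j ∨ (j : ℕ) + 2 ≤ i) :
    (TL.t i * TL.t j : TL n) = TL.t j * TL.t i := by
  simpa [TL.t] using RingQuot.mkAlgHom_rel ℂ (TLRel.comm i j hij)

theorem TL.sub_one_sq {n : ℕ} (i : Fin (n - 1)) :
    ((TL.t i - 1) * (TL.t i - 1) : TL n) = 1 := by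
  have h := TL.t_sq i
  rw [two_smul] at h
  simp only [sub_mul, mul_sub, one_mul, mul_one, h]
  abel

theorem TL.sub_one_braid {n : ℕ} (i j : Fin (n - 1)) (hij : (j : ℕ) = i + 1) :
    ((TL.t j - 1) * (TL.t i - 1) * (TL.t j - 1) : TL n) =
      (TL.t i - 1) * (TL.t j - 1) * (TL.t i - 1) := by
  have h1 := TL.t_sq i
  have h2 := TL.t_sq j
  have h3 := TL.t_braid i j (by omega)
  have h4 := TL.t_braid j i (by omega)
  rw [two_smul] at h1 h2
  simp only [sub_mul, mul_sub, one_mul, mul_one, h1, h2, h3, h4]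
  abel

theorem TL.sub_one_comm {n : ℕ} (i j : Fin (n - 1)) (hij : (i : ℕ) + 2 ≤ j) :
    ((TL.t i - 1) * (TL.t j - 1) : TL n) = (TL.t j - 1) * (TL.t i - 1) := by
  have h := TL.t_comm i j (Or.inl hij)
  simp only [sub_mul, mul_sub, one_mul, mul_one, h]
  abel

/-- The symmetric group on `n` letters in which permutations are composed from left to right. -/
abbrev SymGrp (n : ℕ) : Type := (Equiv.Perm (Fin n))ᵐᵒᵖ

/-- The algebra homomorphism `θ : ℂ[S_n] → TL_n(2)` with `θ(s_i) = t_i - 1`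
(permutations are composed from left to right; `s_i` is its own inverse, so that reversing the
order of composition amounts to inverting the permutation). -/
noncomputable def theta (n : ℕ) : MonoidAlgebra ℂ (SymGrp n) →ₐ[ℂ] TL n :=
  MonoidAlgebra.lift ℂ (TL n) (SymGrp n)
    ((permLift (fun i : Fin (n - 1) => (TL.t i - 1 : TL n)) TL.sub_one_sq TL.sub_one_braid
      TL.sub_one_comm).comp (MulEquiv.inv' (Equiv.Perm (Fin n))).symm.toMonoidHom)

theorem theta_simpleSwap (n : ℕ) (i : Fin (n - 1)) :
    theta n (MonoidAlgebra.single (MulOpposite.op (simpleSwap n i)) 1) = TL.t i - 1 := by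
  have h : (simpleSwap n i)⁻¹ = simpleSwap n i := by simp [simpleSwap]
  simp [theta, h, permLift_simpleSwap]

/-- A Kauffman diagram on `2n` boundary points, i.e. a nonintersecting perfect matching of the
points `A_1, …, A_n` (left side) and `B_1, …, B_n` (right side) of a rectangle. The points are
numbered along the boundary of the rectangle: `A_i` has the number `i - 1` and `B_i` has the number
`2n - i`. `partner` sends a point to the other end of its edge; two edges `{x, partner x}` and
`{y, partner y}` inside the rectangle can be drawn without intersection iff their ends do not
alternate along the boundary. -/
@[ext]
structure KauffmanDiagram (n : ℕ) where
  partner : Equiv.Perm (Fin (2 * n))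
  partner_partner : ∀ x, partner (partner x) = x
  partner_ne : ∀ x, partner x ≠ x
  noncrossing : ∀ x y, x < y → y < partner x → ¬ partner x < partner y

namespace KauffmanDiagram

variable {n : ℕ}

/-- The diagram of the identity: `A_i` is joined to `B_i` for all `i`. -/
def one (n : ℕ) : KauffmanDiagram n where
  partner := Fin.revPerm
  partner_partner x := by simp
  partner_ne x := by
    intro h
    have := congrArg Fin.val h
    simp [Fin.val_rev] at this
    omega
  noncrossing x y hxy _ h := by
    simp at h
    exact absurd hxy (not_lt.mpr h.le)

/-- The left boundary point `A_{i+1}` (`i` counted from `0`). -/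
def ptA (i : Fin (n - 1)) : Fin (2 * n) := ⟨i, by omega⟩

/-- The left boundary point `A_{i+2}` (`i` counted from `0`). -/
def ptA' (i : Fin (n - 1)) : Fin (2 * n) := ⟨i + 1, by omega⟩

/-- The partner map after joining the diagram of `t_i` to the left side of `d`. -/
def cupPerm (i : Fin (n - 1)) (d : KauffmanDiagram n) : Equiv.Perm (Fin (2 * n)) :=
  Equiv.swap (ptA' i) (d.partner (ptA i)) * d.partner * Equiv.swap (ptA' i) (d.partner (ptA i))

theorem cupPerm_apply (i : Fin (n - 1)) (d : KauffmanDiagram n) (x : Fin (2 * n)) :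
    cupPerm i d x = if x = ptA i then ptA' i else if x = ptA' i then ptA i
      else if x = d.partner (ptA i) then d.partner (ptA' i)
      else if x = d.partner (ptA' i) then d.partner (ptA i) else d.partner x := by
  have h1 := d.partner_partner
  have h2 := d.partner_ne
  have h3 : ptA i ≠ ptA' i := by simp [ptA, ptA', Fin.ext_iff]
  simp only [cupPerm, Equiv.Perm.mul_apply, Equiv.swap_apply_def]
  grind

/-- The diagram obtained by joining the diagram of `t_i` to the left side of `d` and removing
the loop, if there is one: `A_i` and `A_{i+1}` become partners, and so do the former partners of
`A_i` and `A_{i+1}`, unless these two points were partners already. -/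
def cup (i : Fin (n - 1)) (d : KauffmanDiagram n) : KauffmanDiagram n where
  partner := cupPerm i d
  partner_partner x := by
    simp [cupPerm, d.partner_partner]
  partner_ne x h := by
    apply d.partner_ne (Equiv.swap (ptA' i) (d.partner (ptA i)) x)
    apply (Equiv.swap (ptA' i) (d.partner (ptA i))).injective
    simpa [cupPerm] using h
  noncrossing x y h1 h2 h3 := by
    have k1 := d.partner_partner
    have k2 := d.partner_ne
    have k3 := d.noncrossing
    have hA : (ptA' i : ℕ) = (ptA i : ℕ) + 1 := rfl
    have e1 := k1 x
    have e2 := k1 y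
    have e3 := k1 (ptA i)
    have e4 := k1 (ptA' i)
    rw [cupPerm_apply] at h2 h3
    rw [cupPerm_apply] at h3
    simp only [Fin.lt_def] at k3 h1 h2 h3
    have q1 := k3 (ptA i) x
    have q2 := k3 x (ptA i)
    have q3 := k3 (ptA i) y
    have q4 := k3 y (ptA i)
    have q5 := k3 (ptA' i) x
    have q6 := k3 x (ptA' i)
    have q7 := k3 (ptA' i) y
    have q8 := k3 y (ptA' i)
    have q9 := k3 x y
    have q10 := k3 (ptA i) (ptA' i)
    split_ifs at h2 h3 <;> simp only [Fin.ext_iff] at * <;> grind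

theorem cup_apply (i : Fin (n - 1)) (d : KauffmanDiagram n) (x : Fin (2 * n)) :
    (cup i d).partner x = if x = ptA i then ptA' i else if x = ptA' i then ptA i
      else if x = d.partner (ptA i) then d.partner (ptA' i)
      else if x = d.partner (ptA' i) then d.partner (ptA i) else d.partner x :=
  cupPerm_apply i d x

/-- The scalar that arises when the diagram of `t_i` is joined to the left side of `d`: it is `2`
if a loop is formed and removed, and `1` otherwise. -/
def loopFactor (i : Fin (n - 1)) (d : KauffmanDiagram n) : ℂ :=
  if d.partner (ptA i) = ptA' i then 2 else 1

theorem cup_cup_self (i : Fin (n - 1)) (d : KauffmanDiagram n) : cup i (cup i d) = cup i d := by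
  have h1 := d.partner_partner
  have h2 := d.partner_ne
  have h3 : ptA i ≠ ptA' i := by simp [ptA, ptA', Fin.ext_iff]
  ext x
  congr 1
  simp only [cup_apply]
  grind

theorem loopFactor_cup_self (i : Fin (n - 1)) (d : KauffmanDiagram n) :
    loopFactor i (cup i d) = 2 := by
  simp [loopFactor, cup_apply]

theorem ptA'_eq_ptA (i j : Fin (n - 1)) (hij : (i : ℕ) + 1 = j) : (ptA' i : Fin (2 * n)) = ptA j := by
  simp [ptA, ptA', hij]

theorem ptA_inj (i j : Fin (n - 1)) (h : (ptA i : Fin (2 * n)) = ptA j) : i = j := by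
  simpa [ptA, Fin.ext_iff] using h

theorem cup_cup_cup (i j : Fin (n - 1)) (hij : (i : ℕ) + 1 = j ∨ (j : ℕ) + 1 = i)
    (d : KauffmanDiagram n) : cup i (cup j (cup i d)) = cup i d := by
  have h1 := d.partner_partner
  have h2 := d.partner_ne
  have h3 : ptA i ≠ ptA' i := by simp [ptA, ptA', Fin.ext_iff]
  have h4 : ptA j ≠ ptA' j := by simp [ptA, ptA', Fin.ext_iff]
  ext x
  congr 1
  rcases hij with hij | hij
  · have h5 := ptA'_eq_ptA i j hij
    have h6 : ptA i ≠ ptA' j := by simp only [ptA, ptA', ne_eq, Fin.ext_iff]; omega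
    simp only [cup_apply]
    grind
  · have h5 := ptA'_eq_ptA j i hij
    have h6 : ptA j ≠ ptA' i := by simp only [ptA, ptA', ne_eq, Fin.ext_iff]; omega
    simp only [cup_apply]
    grind

theorem loopFactor_cup_cup (i j : Fin (n - 1)) (hij : (i : ℕ) + 1 = j ∨ (j : ℕ) + 1 = i)
    (d : KauffmanDiagram n) : loopFactor j (cup i d) = 1 := by
  unfold loopFactor
  rw [if_neg]
  have h3 : ptA i ≠ ptA' i := by simp [ptA, ptA', Fin.ext_iff]
  have h4 : ptA j ≠ ptA' j := by simp [ptA, ptA', Fin.ext_iff]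
  have h1 := d.partner_partner
  have h2 := d.partner_ne
  rcases hij with hij | hij
  · have h5 := ptA'_eq_ptA i j hij
    have h6 : ptA i ≠ ptA' j := by simp only [ptA, ptA', ne_eq, Fin.ext_iff]; omega
    simp only [cup_apply]
    grind
  · have h5 := ptA'_eq_ptA j i hij
    have h6 : ptA j ≠ ptA' i := by simp only [ptA, ptA', ne_eq, Fin.ext_iff]; omega
    simp only [cup_apply]
    grind

theorem loopFactor_cup_cup_cup (i j : Fin (n - 1)) (hij : (i : ℕ) + 1 = j ∨ (j : ℕ) + 1 = i)
    (d : KauffmanDiagram n) : loopFactor i (cup j (cup i d)) = 1 :=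
  loopFactor_cup_cup j i hij.symm (cup i d)

theorem cup_comm (i j : Fin (n - 1)) (hij : (i : ℕ) + 2 ≤ j) (d : KauffmanDiagram n) :
    cup i (cup j d) = cup j (cup i d) := by
  have h1 := d.partner_partner
  have h2 := d.partner_ne
  have h3 : ptA i ≠ ptA' i := by simp [ptA, ptA', Fin.ext_iff]
  have h4 : ptA j ≠ ptA' j := by simp [ptA, ptA', Fin.ext_iff]
  have h5 : ptA i ≠ ptA' j := by simp only [ptA, ptA', ne_eq, Fin.ext_iff]; omega
  have h6 : ptA j ≠ ptA' i := by simp only [ptA, ptA', ne_eq, Fin.ext_iff]; omega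
  have h7 : ptA j ≠ ptA i := by simp only [ptA, ne_eq, Fin.ext_iff]; omega
  have h8 : ptA' j ≠ ptA' i := by simp only [ptA', ne_eq, Fin.ext_iff]; omega
  ext x
  congr 1
  simp only [cup_apply]
  grind (splits := 25)

theorem loopFactor_comm (i j : Fin (n - 1)) (hij : (i : ℕ) + 2 ≤ j) (d : KauffmanDiagram n) :
    loopFactor j d * loopFactor i (cup j d) = loopFactor i d * loopFactor j (cup i d) := by
  have h1 := d.partner_partner
  have h2 := d.partner_ne
  have h3 : ptA i ≠ ptA' i := by simp [ptA, ptA', Fin.ext_iff]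
  have h4 : ptA j ≠ ptA' j := by simp [ptA, ptA', Fin.ext_iff]
  have h5 : ptA i ≠ ptA' j := by simp only [ptA, ptA', ne_eq, Fin.ext_iff]; omega
  have h6 : ptA j ≠ ptA' i := by simp only [ptA, ptA', ne_eq, Fin.ext_iff]; omega
  have h7 : ptA j ≠ ptA i := by simp only [ptA, ne_eq, Fin.ext_iff]; omega
  have h8 : ptA' j ≠ ptA' i := by simp only [ptA', ne_eq, Fin.ext_iff]; omega
  unfold loopFactor
  simp only [cup_apply]
  grind

/-- Concatenation with the diagram of `t_i` on the left, extended linearly to the space with the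
basis of all Kauffman diagrams. -/
noncomputable def genAct (i : Fin (n - 1)) : Module.End ℂ (KauffmanDiagram n →₀ ℂ) :=
  Finsupp.linearCombination ℂ fun d => Finsupp.single (cup i d) (loopFactor i d)

theorem genAct_single (i : Fin (n - 1)) (d : KauffmanDiagram n) (c : ℂ) :
    genAct i (Finsupp.single d c) = Finsupp.single (cup i d) (c * loopFactor i d) := by
  simp [genAct]

theorem genAct_rel (x y : FreeAlgebra ℂ (Fin (n - 1))) (h : TLRel n x y) :
    FreeAlgebra.lift ℂ (genAct (n := n)) x = FreeAlgebra.lift ℂ (genAct (n := n)) y := by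
  have hcomm : ∀ i j : Fin (n - 1), (i : ℕ) + 2 ≤ j →
      (genAct i * genAct j : Module.End ℂ (KauffmanDiagram n →₀ ℂ)) = genAct j * genAct i := by
    intro i j hij
    refine Finsupp.lhom_ext fun d c => ?_
    simp only [Module.End.mul_apply, genAct_single, cup_comm i j hij, mul_assoc,
      loopFactor_comm i j hij]
  cases h with
  | sq i =>
    simp only [map_mul, map_smul, FreeAlgebra.lift_ι_apply]
    refine Finsupp.lhom_ext fun d c => ?_
    simp only [Module.End.mul_apply, genAct_single, cup_cup_self, loopFactor_cup_self,
      LinearMap.smul_apply, Finsupp.smul_single, smul_eq_mul, mul_comm]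
  | braid i j hij =>
    simp only [map_mul, FreeAlgebra.lift_ι_apply]
    refine Finsupp.lhom_ext fun d c => ?_
    simp only [Module.End.mul_apply, genAct_single, cup_cup_cup i j hij, loopFactor_cup_cup i j hij,
      loopFactor_cup_cup_cup i j hij, mul_one]
  | comm i j hij =>
    simp only [map_mul, FreeAlgebra.lift_ι_apply]
    rcases hij with hij | hij
    · exact hcomm i j hij
    · exact (hcomm j i hij).symm

end KauffmanDiagram

/-- The action of `TL_n(2)` by concatenation of diagrams from the left. -/
noncomputable def diagramAction (n : ℕ) :
    TL n →ₐ[ℂ] Module.End ℂ (KauffmanDiagram n →₀ ℂ) :=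
  RingQuot.liftAlgHom ℂ ⟨FreeAlgebra.lift ℂ KauffmanDiagram.genAct,
    fun {x y} h => KauffmanDiagram.genAct_rel x y h⟩

theorem diagramAction_t {n : ℕ} (i : Fin (n - 1)) :
    diagramAction n (TL.t i) = KauffmanDiagram.genAct i := by
  simp [diagramAction, TL.t]

/-- The expansion of an element of `TL_n(2)` in the basis of Kauffman diagrams: a product of
generators `t_{i_1} ⋯ t_{i_k}` is sent to the concatenation of their diagrams, in which each removed
loop has been replaced by a factor `2`. -/
noncomputable def diagramExpansion {n : ℕ} (x : TL n) : KauffmanDiagram n →₀ ℂ :=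
  diagramAction n x (Finsupp.single (KauffmanDiagram.one n) 1)

/-- `f_τ(w)`: the coefficient of `τ` in `θ(w)`. -/
noncomputable def tlFun {n : ℕ} (τ : KauffmanDiagram n) (w : Equiv.Perm (Fin n)) : ℂ :=
  diagramExpansion (theta n (MonoidAlgebra.single (MulOpposite.op w) 1)) τ

/-- The `f`-immanant of a square matrix. -/
def immanant {n : ℕ} {A : Type*} [CommRing A] [Algebra ℂ A] (f : Equiv.Perm (Fin n) → ℂ)
    (M : Matrix (Fin n) (Fin n) A) : A :=
  ∑ w : Equiv.Perm (Fin n), f w • ∏ i, M i (w i)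

/-- The Temperley-Lieb immanant for the Kauffman diagram `τ`. -/
noncomputable def tlImmanant {n : ℕ} {A : Type*} [CommRing A] [Algebra ℂ A]
    (τ : KauffmanDiagram n) (M : Matrix (Fin n) (Fin n) A) : A :=
  immanant (tlFun τ) M

open Classical in
/-- The elementary symmetric function `e_d` in the variables `x_0, x_1, …`, as a formal power
series: the sum of all monomials of degree `d` in which every exponent is at most `1`
(so that `e_0 = 1`, and `e_d = 0` for `d < 0`). -/
noncomputable def elemSymm (d : ℤ) : MvPowerSeries ℕ ℂ := fun a =>
  if (∀ k, a k ≤ 1) ∧ ((a.degree : ℕ) : ℤ) = d then 1 else 0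

/-- The matrix `(e_{λ_i - μ_j - i + j})` of size `n`; for `n = ℓ(λ)` this is the (dual)
Jacobi-Trudi matrix of `λ/μ`. -/
noncomputable def jacobiTrudi (n : ℕ) (l μ : YoungDiagram) :
    Matrix (Fin n) (Fin n) (MvPowerSeries ℕ ℂ) :=
  Matrix.of fun i j =>
    elemSymm ((l.rowLen i : ℤ) - (μ.rowLen j : ℤ) - ((i : ℕ) : ℤ) + ((j : ℕ) : ℤ))

/-- The skew Schur function `s_{λ/μ}`, the determinant of the matrix
`(e_{λ'_i - μ'_j - i + j})` of size `ℓ(λ')`. -/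
noncomputable def skewSchur (l μ : YoungDiagram) : MvPowerSeries ℕ ℂ :=
  (jacobiTrudi (l.transpose.colLen 0) l.transpose μ.transpose).det

/-- The partition `(1^m)`: a column of `m` cells. -/
def column (m : ℕ) : YoungDiagram where
  cells := Finset.range m ×ˢ {0}
  isLowerSet := by
    rintro ⟨a, b⟩ ⟨c, d⟩ ⟨h1, h2⟩ h
    simp only [Finset.coe_product, Set.mem_prod, Finset.mem_coe, Finset.mem_range,
      Finset.mem_singleton] at h ⊢
    simp only at h1 h2
    omega

/-- `(1^m)` has `m` rows, so that its Jacobi-Trudi matrix is the one of size `m`. -/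
theorem column_length (m : ℕ) : (column m).colLen 0 = m := by
  have h : ∀ i, i < (column m).colLen 0 ↔ i < m := fun i => by
    rw [← YoungDiagram.mem_iff_lt_colLen, ← YoungDiagram.mem_cells]
    simp [column]
  exact le_antisymm (not_lt.mp fun hlt => lt_irrefl m ((h m).mp hlt))
    (not_lt.mp fun hlt => lt_irrefl _ ((h _).mpr hlt))

/-- The cells of the skew shape `λ/μ`. -/
def skewCells (l μ : YoungDiagram) : Finset (ℕ × ℕ) := l.cells \ μ.cells

/-- Two cells share an edge. -/
def CellAdj (c d : ℕ × ℕ) : Prop :=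
  (c.1 = d.1 ∧ (c.2 + 1 = d.2 ∨ d.2 + 1 = c.2)) ∨ (c.2 = d.2 ∧ (c.1 + 1 = d.1 ∨ d.1 + 1 = c.1))

/-- `λ/μ` is a ribbon: a skew shape that is connected (any two cells are joined by a path of
cells that successively share an edge) and has no `2 × 2` block of cells. -/
structure IsRibbon (l μ : YoungDiagram) : Prop where
  le : μ ≤ l
  connected : ∀ c ∈ skewCells l μ, ∀ d ∈ skewCells l μ, Relation.ReflTransGen
    (fun a b => a ∈ skewCells l μ ∧ b ∈ skewCells l μ ∧ CellAdj a b) c d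
  no_block : ∀ i j, ¬ ((i, j) ∈ skewCells l μ ∧ (i + 1, j) ∈ skewCells l μ ∧
    (i, j + 1) ∈ skewCells l μ ∧ (i + 1, j + 1) ∈ skewCells l μ)

/-- The set of ribbons `λ/μ` of size `m` with `{i : λ_i > μ_i} = [ℓ(λ)]`
(rows are counted from `0` here). -/
def ribbons (m : ℕ) : Set (YoungDiagram × YoungDiagram) :=
  {R | IsRibbon R.1 R.2 ∧ (skewCells R.1 R.2).card = m ∧
    ∀ i, R.2.rowLen i < R.1.rowLen i ↔ i < R.1.colLen 0}

end TLImm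

/-!
In the matrix with entries `e (lᵢ + ⋯ + lⱼ)`, the subdiagonal entries are `e 0 = 1` and everything
below them vanishes; `JT_{(1^m)}` is the case `l = (1, …, 1)`. Expanding an immanant along column
`0` therefore leaves two terms, and since the transposition `(1, 2)` maps to `t_1 - 1`, the part
containing `t_1` merges the first two entries of `l`, while the parts without `t_1` recombine, by
the same expansion of a determinant, without merging. Thus the immanant of `τ` is the sum over
subsets `T ⊆ {1, …, m - 1}` of the coefficient of `τ` in the product of the `t_i`, `i ∈ T`, in
increasing order, times the determinant for the composition of `m` that `T` defines. These
products create no loops and are pairwise distinct Kauffman diagrams, so at most one term survives.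
Finally, the Jacobi–Trudi determinant of a ribbon depends only on its column lengths, and these can
form any composition of `m`.
-/

namespace TLImm

section Immanant

variable {A : Type*} [CommRing A] [Algebra ℂ A] {n : ℕ}

/-- The image of `w` under the embedding of `𝔖_n` into `𝔖_{n+1}` as the stabilizer of `0`. -/
def shiftPerm (w : Equiv.Perm (Fin n)) : Equiv.Perm (Fin (n + 1)) :=
  Equiv.Perm.decomposeFin.symm (0, w)

@[simp]
theorem shiftPerm_zero (w : Equiv.Perm (Fin n)) : shiftPerm w 0 = 0 :=
  Equiv.Perm.decomposeFin_symm_apply_zero 0 w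

@[simp]
theorem shiftPerm_succ (w : Equiv.Perm (Fin n)) (i : Fin n) : shiftPerm w i.succ = (w i).succ := by
  simp [shiftPerm]

@[simp]
theorem shiftPerm_one : shiftPerm (1 : Equiv.Perm (Fin n)) = 1 := by
  ext i
  cases i using Fin.cases <;> simp

theorem shiftPerm_mul (v w : Equiv.Perm (Fin n)) :
    shiftPerm (v * w) = shiftPerm v * shiftPerm w := by
  ext i
  cases i using Fin.cases <;> simp

theorem shiftPerm_swap (i j : Fin n) :
    shiftPerm (Equiv.swap i j) = Equiv.swap i.succ j.succ := by
  ext k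
  cases k using Fin.cases with
  | zero => simp [Equiv.swap_apply_of_ne_of_ne, (Fin.succ_ne_zero _).symm]
  | succ k => simp [(Fin.succ_injective n).swap_apply]

theorem shiftPerm_injective : Function.Injective (shiftPerm (n := n)) :=
  fun _ _ h => (Prod.mk.inj (Equiv.Perm.decomposeFin.symm.injective h)).2

theorem bijective_shiftPerm_mul_cycleRange :
    Function.Bijective
      fun x : Fin (n + 1) × Equiv.Perm (Fin n) => shiftPerm x.2 * x.1.cycleRange := by
  refine (Fintype.bijective_iff_injective_and_card _).mpr
    ⟨?_, by simp [Fintype.card_perm, Nat.factorial_succ]⟩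
  rintro ⟨p, v⟩ ⟨q, w⟩ h
  replace h : shiftPerm v * p.cycleRange = shiftPerm w * q.cycleRange := h
  have hpq : p = q := by
    apply (shiftPerm w * q.cycleRange).injective
    rw [← h]
    simp only [Equiv.Perm.mul_apply, Fin.cycleRange_self, shiftPerm_zero]
    simpa using (congrArg (fun σ => σ q) h).symm
  subst hpq
  rw [shiftPerm_injective (mul_right_cancel h)]

theorem immanant_succ_column_zero (f : Equiv.Perm (Fin (n + 1)) → ℂ)
    (M : Matrix (Fin (n + 1)) (Fin (n + 1)) A) :
    immanant f M = ∑ p, M p 0 *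
      immanant (fun w => f (shiftPerm w * p.cycleRange)) (M.submatrix p.succAbove Fin.succ) := by
  rw [immanant, ← bijective_shiftPerm_mul_cycleRange.sum_comp, Fintype.sum_prod_type]
  refine Finset.sum_congr rfl fun p _ => ?_
  rw [immanant, Finset.mul_sum]
  refine Finset.sum_congr rfl fun w _ => ?_
  rw [Fin.prod_univ_succAbove _ p, mul_smul_comm]
  simp

end Immanant

section RibbonMatrix

variable {A : Type*} {e : ℤ → A}

/-- The matrix of the elements `e (lᵢ + ⋯ + lⱼ)`. Just below the diagonal the sum is empty and the
entry is `e 0`; further below it is `e` of a negative number. -/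
def ribbonMatrix (e : ℤ → A) (n : ℕ) (l : List ℕ) : Matrix (Fin n) (Fin n) A :=
  Matrix.of fun i j => e ((l.take (j + 1)).sum - (l.take i).sum)

theorem ribbonMatrix_apply (n : ℕ) (l : List ℕ) (i j : Fin n) :
    ribbonMatrix e n l i j = e ((l.take (j + 1)).sum - (l.take i).sum) :=
  rfl

theorem ribbonMatrix_cons_submatrix_zero (n a : ℕ) (l : List ℕ) :
    (ribbonMatrix e (n + 1) (a :: l)).submatrix (Fin.succAbove 0) Fin.succ =
      ribbonMatrix e n l := by
  ext i j
  simp [ribbonMatrix_apply]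

theorem ribbonMatrix_cons_cons_submatrix_one (n a b : ℕ) (l : List ℕ) :
    (ribbonMatrix e (n + 2) (a :: b :: l)).submatrix (Fin.succAbove 1) Fin.succ =
      ribbonMatrix e (n + 1) ((a + b) :: l) := by
  ext i j
  cases i using Fin.cases <;> simp [ribbonMatrix_apply, add_assoc]

theorem ribbonMatrix_cons_zero_zero (n a : ℕ) (l : List ℕ) :
    ribbonMatrix e (n + 1) (a :: l) 0 0 = e a := by
  simp [ribbonMatrix_apply]

variable [CommRing A]

/-- The determinant of the ribbon matrix, which for elementary symmetric functions `e` is the skew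
Schur function of the ribbon with column lengths `l`. -/
def ribbonDet (e : ℤ → A) (l : List ℕ) : A :=
  (ribbonMatrix e l.length l).det

theorem ribbonMatrix_cons_one_zero (h0 : e 0 = 1) (n a : ℕ) (l : List ℕ) :
    ribbonMatrix e (n + 2) (a :: l) 1 0 = 1 := by
  simp [ribbonMatrix_apply, h0]

theorem ribbonMatrix_cons_cons_succ_succ_zero (hneg : ∀ d < 0, e d = 0) {n a b : ℕ} (hb : 0 < b)
    (l : List ℕ) (i : Fin n) : ribbonMatrix e (n + 2) (a :: b :: l) i.succ.succ 0 = 0 := by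
  refine hneg _ (sub_neg.mpr (Nat.cast_lt.mpr ?_))
  simpa using Nat.lt_add_right _ hb

theorem ribbonDet_nil : ribbonDet e [] = 1 :=
  Matrix.det_fin_zero

theorem ribbonDet_singleton (a : ℕ) : ribbonDet e [a] = e a := by
  rw [ribbonDet, List.length_singleton, Matrix.det_fin_one, ribbonMatrix_cons_zero_zero]

theorem ribbonDet_cons_cons (h0 : e 0 = 1) (hneg : ∀ d < 0, e d = 0) {a b : ℕ} (hb : 0 < b)
    (l : List ℕ) :
    ribbonDet e (a :: b :: l) = e a * ribbonDet e (b :: l) - ribbonDet e ((a + b) :: l) := by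
  simp only [ribbonDet, List.length_cons]
  rw [Matrix.det_succ_column_zero, Fin.sum_univ_succ, Fin.sum_univ_succ, Fin.succ_zero_eq_one,
    ribbonMatrix_cons_submatrix_zero, ribbonMatrix_cons_cons_submatrix_one,
    ribbonMatrix_cons_zero_zero, ribbonMatrix_cons_one_zero h0]
  simp [ribbonMatrix_cons_cons_succ_succ_zero hneg hb, sub_eq_add_neg]

theorem immanant_ribbonMatrix_cons_cons [Algebra ℂ A] (h0 : e 0 = 1) (hneg : ∀ d < 0, e d = 0)
    {n a b : ℕ} (hb : 0 < b) (l : List ℕ) (f : Equiv.Perm (Fin (n + 2)) → ℂ) :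
    immanant f (ribbonMatrix e (n + 2) (a :: b :: l)) =
      e a * immanant (fun w => f (shiftPerm w)) (ribbonMatrix e (n + 1) (b :: l)) +
        immanant (fun w => f (shiftPerm w * Equiv.swap 0 1))
          (ribbonMatrix e (n + 1) ((a + b) :: l)) := by
  have cycleRange_one : (1 : Fin (n + 2)).cycleRange = Equiv.swap 0 1 := by
    ext i; rw [Fin.cycleRange_apply, Equiv.swap_apply_def]; split_ifs <;> simp_all
  rw [immanant_succ_column_zero, Fin.sum_univ_succ, Fin.sum_univ_succ, Fin.succ_zero_eq_one,
    ribbonMatrix_cons_submatrix_zero, ribbonMatrix_cons_cons_submatrix_one,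
    ribbonMatrix_cons_zero_zero, ribbonMatrix_cons_one_zero h0, cycleRange_one]
  simp [ribbonMatrix_cons_cons_succ_succ_zero hneg hb]

end RibbonMatrix

section Expansion

/-- The list obtained from `a, l 0, …, l (r - 1)` by adding `l i` to the entry on its left for each
`i` with `T i`; it encodes the coarsening of a composition. -/
def coarsen (a : ℕ) : {r : ℕ} → (Fin r → ℕ) → (Fin r → Bool) → List ℕ
  | 0, _, _ => [a]
  | _ + 1, l, T =>
    if T 0 then coarsen (a + l 0) (Fin.tail l) (Fin.tail T)
    else a :: coarsen (l 0) (Fin.tail l) (Fin.tail T)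

theorem coarsen_cons_true {r : ℕ} (a b : ℕ) (l : Fin r → ℕ) (T : Fin r → Bool) :
    coarsen a (Fin.cons b l : Fin (r + 1) → ℕ) (Fin.cons true T : Fin (r + 1) → Bool) =
      coarsen (a + b) l T := by
  simp [coarsen]

theorem coarsen_cons_false {r : ℕ} (a b : ℕ) (l : Fin r → ℕ) (T : Fin r → Bool) :
    coarsen a (Fin.cons b l : Fin (r + 1) → ℕ) (Fin.cons false T : Fin (r + 1) → Bool) =
      a :: coarsen b l T := by
  simp [coarsen]

theorem exists_coarsen_add_eq_cons {r : ℕ} (b : ℕ) (l : Fin r → ℕ) (T : Fin r → Bool) :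
    ∃ c l', b ≤ c ∧ ∀ a, coarsen (a + b) l T = (a + c) :: l' := by
  induction r generalizing b with
  | zero => exact ⟨b, [], le_rfl, fun a => rfl⟩
  | succ r ih =>
    cases l using Fin.consCases with | _ d l
    cases T using Fin.consCases with | _ x T
    cases x
    · exact ⟨b, _, le_rfl, fun a => coarsen_cons_false ..⟩
    · obtain ⟨c, l', hbc, hc⟩ := ih (b + d) l T
      exact ⟨c, l', by omega, fun a => by rw [coarsen_cons_true, add_assoc, hc]⟩

/-- The elements, in increasing order, of the set with indicator function `T`. -/
def sortedList {r : ℕ} (T : Fin r → Bool) : List (Fin r) :=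
  (List.finRange r).filter T

theorem sortedList_cons {r : ℕ} (x : Bool) (T : Fin r → Bool) :
    sortedList (Fin.cons x T : Fin (r + 1) → Bool) =
      if x then 0 :: (sortedList T).map Fin.succ else (sortedList T).map Fin.succ := by
  cases x <;> simp [sortedList, List.finRange_succ, List.filter_map, Function.comp_def]

theorem pairwise_lt_sortedList {r : ℕ} (T : Fin r → Bool) : (sortedList T).Pairwise (· < ·) :=
  (List.pairwise_lt_finRange r).filter T

theorem sortedList_injective {r : ℕ} : Function.Injective (sortedList (r := r)) := by
  intro T U h
  ext i
  simpa [sortedList] using congrArg (fun L => i ∈ L) h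

variable {A : Type*} [CommRing A] {e : ℤ → A}

theorem ribbonDet_cons_coarsen (h0 : e 0 = 1) (hneg : ∀ d < 0, e d = 0) {r : ℕ} (a : ℕ) {b : ℕ}
    (hb : 0 < b) (l : Fin r → ℕ) (T : Fin r → Bool) :
    ribbonDet e (a :: coarsen b l T) =
      e a * ribbonDet e (coarsen b l T) - ribbonDet e (coarsen (a + b) l T) := by
  obtain ⟨c, l', hbc, hc⟩ := exists_coarsen_add_eq_cons b l T
  have hcb : coarsen b l T = c :: l' := by simpa using hc 0
  rw [hc, hcb, ribbonDet_cons_cons h0 hneg (hb.trans_le hbc)]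

theorem sum_cons_bool {M : Type*} [AddCommMonoid M] {r : ℕ} (F : (Fin (r + 1) → Bool) → M) :
    ∑ T, F T = ∑ T : Fin r → Bool, (F (Fin.cons true T) + F (Fin.cons false T)) := by
  rw [← (Fin.consEquiv fun _ => Bool).sum_comp, Fintype.sum_prod_type_right]
  simp [Fin.consEquiv]

variable [Algebra ℂ A] {B : Type*} [Ring B] [Algebra ℂ B]

theorem immanant_sub {n : ℕ} (f g : Equiv.Perm (Fin n) → ℂ) (M : Matrix (Fin n) (Fin n) A) :
    immanant (fun w => f w - g w) M = immanant f M - immanant g M := by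
  simp [immanant, sub_smul, Finset.sum_sub_distrib]

theorem immanant_ribbonMatrix_eq_sum_coarsen (h0 : e 0 = 1) (hneg : ∀ d < 0, e d = 0) {r : ℕ}
    (t : Fin r → B) (ρ : Equiv.Perm (Fin (r + 1)) → B) (h_one : ρ 1 = 1)
    (h_swap : ∀ w i, ρ (w * Equiv.swap i.castSucc i.succ) = (t i - 1) * ρ w)
    (φ : B →ₗ[ℂ] ℂ) (a : ℕ) (l : Fin r → ℕ) (hl : ∀ i, 0 < l i) :
    immanant (fun w => φ (ρ w)) (ribbonMatrix e (r + 1) (a :: List.ofFn l)) =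
      ∑ T, φ ((sortedList T).map t).prod • ribbonDet e (coarsen a l T) := by
  induction r generalizing a φ with
  | zero =>
    simp [immanant, ribbonMatrix_apply, sortedList, coarsen, ribbonDet_singleton,
      Subsingleton.elim _ (1 : Equiv.Perm (Fin 1)), h_one]
  | succ r ih =>
    cases l using Fin.consCases with | _ b l
    obtain ⟨hb, hl⟩ : 0 < b ∧ ∀ i, 0 < l i := by simpa [Fin.forall_fin_succ] using hl
    have expand (ψ : B →ₗ[ℂ] ℂ) (c : ℕ) := ih (fun i => t i.succ) (fun w => ρ (shiftPerm w))
      (by rw [shiftPerm_one, h_one])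
      (fun w i => by rw [shiftPerm_mul, shiftPerm_swap, ← h_swap]; rfl) ψ c l hl
    have swap_zero_one (w) : φ (ρ (shiftPerm w * Equiv.swap 0 1)) =
        (φ ∘ₗ LinearMap.mulLeft ℂ (t 0)) (ρ (shiftPerm w)) - φ (ρ (shiftPerm w)) := by
      rw [← Fin.succ_zero_eq_one, ← Fin.castSucc_zero, h_swap, sub_mul, one_mul, map_sub]
      rfl
    rw [List.ofFn_cons, immanant_ribbonMatrix_cons_cons h0 hneg hb]
    simp only [swap_zero_one, immanant_sub, expand, sum_cons_bool, coarsen_cons_true,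
      coarsen_cons_false, sortedList_cons, ribbonDet_cons_coarsen h0 hneg a hb]
    rw [Finset.mul_sum, ← Finset.sum_sub_distrib, ← Finset.sum_add_distrib]
    refine Finset.sum_congr rfl fun T _ => ?_
    simp [smul_sub, Function.comp_def]
    abel

end Expansion

namespace KauffmanDiagram

variable {n : ℕ}

theorem rev_ptA_ne (i : Fin (n - 1)) : (ptA i : Fin (2 * n)).rev ≠ ptA' i := by
  simp only [ne_eq, Fin.ext_iff, Fin.val_rev, ptA, ptA']
  omega

theorem eq_of_cup_eq {i : Fin (n - 1)} {d d' : KauffmanDiagram n} (h : cup i d = cup i d')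
    (hi : d.partner (ptA i) = d'.partner (ptA i)) : d = d' := by
  replace h : cupPerm i d = cupPerm i d' := congrArg partner h
  rw [cupPerm, cupPerm, hi, mul_left_inj, mul_right_inj] at h
  exact KauffmanDiagram.ext h

/-- The diagram of the product `t_{i_1} ⋯ t_{i_k}` of generators, without regard to loops. -/
def wordDiagram (is : List (Fin (n - 1))) : KauffmanDiagram n :=
  is.foldr cup (one n)

theorem wordDiagram_partner_of_lt {is : List (Fin (n - 1))} {x : Fin (2 * n)}
    (hx : ∀ i ∈ is, (x : ℕ) < i) : (wordDiagram is).partner x = x.rev := by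
  induction is with
  | nil => rfl
  | cons i is ih =>
    obtain ⟨hxi, hx⟩ := List.forall_mem_cons.mp hx
    change (cup i (wordDiagram is)).partner x = x.rev
    have rev_ne (y : Fin (2 * n)) (hy : (y : ℕ) < n) : x ≠ (wordDiagram is).partner y := by
      intro hxy
      have : x.rev = y := by rw [← ih hx, hxy, partner_partner]
      simp only [Fin.ext_iff, Fin.val_rev] at this
      omega
    rw [cup_apply, if_neg, if_neg, if_neg (rev_ne _ _), if_neg (rev_ne _ _), ih hx]
    all_goals simp only [Fin.ext_iff, ptA, ptA']; omega

theorem wordDiagram_cons_ne (i : Fin (n - 1)) (is : List (Fin (n - 1))) {js : List (Fin (n - 1))}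
    (hjs : ∀ j ∈ js, i < j) : wordDiagram (i :: is) ≠ wordDiagram js := by
  intro h
  have h_cons : (wordDiagram (i :: is)).partner (ptA i) = ptA' i := by
    change (cup i (wordDiagram is)).partner (ptA i) = ptA' i
    rw [cup_apply, if_pos rfl]
  rw [h, wordDiagram_partner_of_lt hjs] at h_cons
  exact rev_ptA_ne i h_cons

theorem wordDiagram_injOn :
    Set.InjOn wordDiagram {is : List (Fin (n - 1)) | is.Pairwise (· < ·)} := by
  intro is his js hjs h
  induction is generalizing js with
  | nil =>
    cases js with
    | nil => rfl
    | cons j js => exact absurd h.symm (wordDiagram_cons_ne j js (by simp))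
  | cons i is ih =>
    cases js with
    | nil => exact absurd h (wordDiagram_cons_ne i is (by simp))
    | cons j js =>
      obtain ⟨hi, h_is⟩ := List.pairwise_cons.mp his
      obtain ⟨hj, h_js⟩ := List.pairwise_cons.mp hjs
      rcases lt_trichotomy i j with hij | rfl | hji
      · exact absurd h (wordDiagram_cons_ne i is
          (List.forall_mem_cons.mpr ⟨hij, fun k hk => hij.trans (hj k hk)⟩))
      · have h_tail : wordDiagram is = wordDiagram js := eq_of_cup_eq (i := i) h (by
          rw [wordDiagram_partner_of_lt hi, wordDiagram_partner_of_lt hj])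
        rw [ih h_is h_js h_tail]
      · exact absurd h.symm (wordDiagram_cons_ne j js
          (List.forall_mem_cons.mpr ⟨hji, fun k hk => hji.trans (hi k hk)⟩))

theorem diagramExpansion_t_mul (i : Fin (n - 1)) (x : TL n) :
    diagramExpansion (TL.t i * x) = genAct i (diagramExpansion x) := by
  rw [diagramExpansion, map_mul, Module.End.mul_apply, diagramAction_t, diagramExpansion]

theorem diagramExpansion_prod_t {is : List (Fin (n - 1))} (his : is.Pairwise (· < ·)) :
    diagramExpansion (is.map TL.t).prod = Finsupp.single (wordDiagram is) 1 := by
  induction is with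
  | nil => simp [diagramExpansion, wordDiagram]
  | cons i is ih =>
    obtain ⟨hi, his⟩ := List.pairwise_cons.mp his
    have loopFactor_eq_one : loopFactor i (wordDiagram is) = 1 := by
      rw [loopFactor, wordDiagram_partner_of_lt hi, if_neg (rev_ptA_ne i)]
    rw [List.map_cons, List.prod_cons, diagramExpansion_t_mul, ih his, genAct_single,
      loopFactor_eq_one, one_mul]
    rfl

end KauffmanDiagram

section Compositions

theorem sum_coarsen {r : ℕ} (a : ℕ) (l : Fin r → ℕ) (T : Fin r → Bool) :
    (coarsen a l T).sum = a + ∑ i, l i := by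
  induction r generalizing a with
  | zero => simp [coarsen]
  | succ r ih =>
    cases l using Fin.consCases with | _ b l
    cases T using Fin.consCases with | _ x T
    cases x <;> simp [coarsen_cons_true, coarsen_cons_false, ih, Fin.sum_univ_succ, add_assoc]

theorem pos_of_mem_coarsen {r : ℕ} {a : ℕ} (ha : 0 < a) {l : Fin r → ℕ} (hl : ∀ i, 0 < l i)
    (T : Fin r → Bool) {x : ℕ} (hx : x ∈ coarsen a l T) : 0 < x := by
  induction r generalizing a with
  | zero =>
    obtain rfl : x = a := by simpa [coarsen] using hx
    exact ha
  | succ r ih =>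
    cases l using Fin.consCases with | _ b l
    cases T using Fin.consCases with | _ y T
    obtain ⟨hb, hl⟩ : 0 < b ∧ ∀ i, 0 < l i := by simpa [Fin.forall_fin_succ] using hl
    cases y with
    | true => exact ih (Nat.add_pos_left ha b) hl T (by rwa [coarsen_cons_true] at hx)
    | false =>
      rw [coarsen_cons_false, List.mem_cons] at hx
      rcases hx with rfl | hx
      exacts [ha, ih hb hl T hx]

theorem exists_coarsen_one_eq_cons {r a b : ℕ} {L : List ℕ} (hab : a ≤ b) (hL : ∀ x ∈ L, 0 < x)
    (h_sum : b + L.sum = a + r) :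
    ∃ T : Fin r → Bool, coarsen a (fun _ => 1) T = b :: L := by
  have cons_one (r : ℕ) : (fun _ => 1 : Fin (r + 1) → ℕ) = Fin.cons 1 fun _ => 1 := by
    ext i; cases i using Fin.cases <;> rfl
  induction r generalizing a b L with
  | zero =>
    cases L with
    | nil => exact ⟨finZeroElim, by simp [coarsen]; simpa using h_sum.symm⟩
    | cons c L =>
      have := hL c (by simp)
      simp only [List.sum_cons] at h_sum
      omega
  | succ r ih =>
    rcases hab.lt_or_eq with hab | rfl
    · obtain ⟨T, hT⟩ := ih (a := a + 1) hab hL (by omega)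
      exact ⟨Fin.cons true T, by rw [cons_one, coarsen_cons_true, hT]⟩
    · cases L with
      | nil => simp at h_sum
      | cons c L =>
        obtain ⟨hc, hL⟩ := List.forall_mem_cons.mp hL
        obtain ⟨T, hT⟩ := ih (a := 1) (Nat.succ_le_of_lt hc) hL (by
          rw [List.sum_cons] at h_sum
          omega)
        exact ⟨Fin.cons false T, by rw [cons_one, coarsen_cons_false, hT]⟩

theorem exists_coarsen_one_eq_blocks {r : ℕ} (c : Composition (r + 1)) :
    ∃ T : Fin r → Bool, coarsen 1 (fun _ => 1) T = c.blocks := by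
  rcases h : c.blocks with _ | ⟨b, L⟩
  · simpa [h] using c.blocks_sum
  · have h_sum := c.blocks_sum
    have h_pos : ∀ x ∈ b :: L, 0 < x := fun x hx => c.blocks_pos (h ▸ hx)
    obtain ⟨hb, hL⟩ := List.forall_mem_cons.mp h_pos
    rw [h, List.sum_cons] at h_sum
    exact exists_coarsen_one_eq_cons hb hL (by omega)

theorem exists_blocks_eq_coarsen_one {r : ℕ} (T : Fin r → Bool) :
    ∃ c : Composition (r + 1), c.blocks = coarsen 1 (fun _ => 1) T :=
  ⟨⟨coarsen 1 (fun _ => 1) T, pos_of_mem_coarsen one_pos (fun _ => one_pos) T,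
    by simp [sum_coarsen, add_comm]⟩, rfl⟩

end Compositions

section TemperleyLiebImmanant

theorem elemSymm_zero : elemSymm 0 = 1 := by
  classical
  ext a
  rw [MvPowerSeries.coeff_one]
  change (if (∀ k, a k ≤ 1) ∧ ((a.degree : ℕ) : ℤ) = 0 then (1 : ℂ) else 0) = _
  refine if_congr ⟨fun h => ?_, ?_⟩ rfl rfl
  · exact (Finsupp.degree_eq_zero_iff a).1 (by exact_mod_cast h.2)
  · rintro rfl
    simp

theorem elemSymm_of_neg (d : ℤ) (hd : d < 0) : elemSymm d = 0 := by
  ext a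
  exact if_neg fun h => by omega

theorem column_rowLen {m i : ℕ} (hi : i < m) : (column m).rowLen i = 1 := by
  refine eq_of_forall_lt_iff fun j => ?_
  rw [← YoungDiagram.mem_iff_lt_rowLen, ← YoungDiagram.mem_cells]
  simp [column, hi, eq_comm]

theorem bot_rowLen (i : ℕ) : (⊥ : YoungDiagram).rowLen i = 0 :=
  Nat.eq_zero_of_not_pos fun h => YoungDiagram.notMem_bot _ (YoungDiagram.mem_iff_lt_rowLen.2 h)

theorem jacobiTrudi_column_bot (m : ℕ) :
    jacobiTrudi m (column m) ⊥ = ribbonMatrix elemSymm m (List.replicate m 1) := by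
  ext1 i j
  have hij : min (j + 1 : ℕ) m = j + 1 ∧ min (i : ℕ) m = i := by omega
  simp only [jacobiTrudi, ribbonMatrix_apply, Matrix.of_apply, column_rowLen i.isLt, bot_rowLen,
    List.take_replicate, List.sum_replicate, smul_eq_mul, mul_one, hij]
  congr 1
  push_cast
  ring

/-- The coefficient of `τ` in the expansion into Kauffman diagrams, as a linear functional. -/
noncomputable def diagramCoeff {n : ℕ} (τ : KauffmanDiagram n) : TL n →ₗ[ℂ] ℂ :=
  Finsupp.lapply τ ∘ₗ LinearMap.applyₗ (Finsupp.single (KauffmanDiagram.one n) (1 : ℂ)) ∘ₗ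
    (diagramAction n).toLinearMap

theorem theta_single_one (n : ℕ) :
    theta n (MonoidAlgebra.single (MulOpposite.op (1 : Equiv.Perm (Fin n))) 1) = 1 := by
  rw [MulOpposite.op_one, ← MonoidAlgebra.one_def, map_one]

theorem theta_single_mul_simpleSwap {n : ℕ} (w : Equiv.Perm (Fin n)) (i : Fin (n - 1)) :
    theta n (MonoidAlgebra.single (MulOpposite.op (w * simpleSwap n i)) 1) =
      (TL.t i - 1) * theta n (MonoidAlgebra.single (MulOpposite.op w) 1) := by
  rw [MulOpposite.op_mul, ← theta_simpleSwap, ← map_mul, MonoidAlgebra.single_mul_single, mul_one]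

variable {A : Type*} [CommRing A] [Algebra ℂ A] {e : ℤ → A}

theorem tlImmanant_fin_zero (τ : KauffmanDiagram 0) (M : Matrix (Fin 0) (Fin 0) A) :
    tlImmanant τ M = 1 := by
  have one_eq : KauffmanDiagram.one 0 = τ := KauffmanDiagram.ext (Equiv.ext fun x => x.elim0)
  have tlFun_one : tlFun τ 1 = 1 := by
    rw [tlFun, theta_single_one, diagramExpansion, map_one, Module.End.one_apply, one_eq,
      Finsupp.single_eq_same]
  simp [tlImmanant, immanant, Subsingleton.elim _ (1 : Equiv.Perm (Fin 0)), tlFun_one]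

open KauffmanDiagram

theorem tlImmanant_ribbonMatrix (h0 : e 0 = 1) (hneg : ∀ d < 0, e d = 0) {r : ℕ}
    (τ : KauffmanDiagram (r + 1)) (a : ℕ) {l : Fin r → ℕ} (hl : ∀ i, 0 < l i) :
    tlImmanant τ (ribbonMatrix e (r + 1) (a :: List.ofFn l)) =
      ∑ T : Fin r → Bool, Finsupp.single (wordDiagram (n := r + 1) (sortedList T)) (1 : ℂ) τ •
        ribbonDet e (coarsen a l T) := by
  have expansion := immanant_ribbonMatrix_eq_sum_coarsen h0 hneg (TL.t (n := r + 1))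
    (fun w => theta (r + 1) (MonoidAlgebra.single (MulOpposite.op w) 1)) (theta_single_one _)
    theta_single_mul_simpleSwap (diagramCoeff τ) a l hl
  refine expansion.trans (Finset.sum_congr rfl fun T _ => ?_)
  rw [← diagramExpansion_prod_t (pairwise_lt_sortedList T)]
  rfl

theorem tlImmanant_wordDiagram_ribbonMatrix (h0 : e 0 = 1) (hneg : ∀ d < 0, e d = 0) {r : ℕ}
    (a : ℕ) {l : Fin r → ℕ} (hl : ∀ i, 0 < l i) (T : Fin r → Bool) :
    tlImmanant (wordDiagram (n := r + 1) (sortedList T))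
      (ribbonMatrix e (r + 1) (a :: List.ofFn l)) = ribbonDet e (coarsen a l T) := by
  rw [tlImmanant_ribbonMatrix h0 hneg _ a hl, Fintype.sum_eq_single T, Finsupp.single_eq_same,
    one_smul]
  intro U hUT
  rw [Finsupp.single_eq_of_ne, zero_smul]
  exact fun h => hUT (sortedList_injective (wordDiagram_injOn (pairwise_lt_sortedList U)
    (pairwise_lt_sortedList T) h.symm))

theorem exists_eq_wordDiagram_of_tlImmanant_ribbonMatrix_ne_zero (h0 : e 0 = 1)
    (hneg : ∀ d < 0, e d = 0) {r : ℕ} {τ : KauffmanDiagram (r + 1)} {a : ℕ} {l : Fin r → ℕ}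
    (hl : ∀ i, 0 < l i) (h : tlImmanant τ (ribbonMatrix e (r + 1) (a :: List.ofFn l)) ≠ 0) :
    ∃ T : Fin r → Bool, wordDiagram (n := r + 1) (sortedList T) = τ := by
  contrapose! h
  rw [tlImmanant_ribbonMatrix h0 hneg τ a hl]
  refine Finset.sum_eq_zero fun T _ => ?_
  rw [Finsupp.single_eq_of_ne (h T).symm, zero_smul]

theorem replicate_succ_one_eq_cons_ofFn (r : ℕ) :
    List.replicate (r + 1) 1 = 1 :: List.ofFn fun _ : Fin r => 1 := by
  rw [List.replicate_succ, List.ofFn_const]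

theorem exists_tlImmanant_eq_ribbonDet {m : ℕ} (c : Composition m) :
    ∃ τ : KauffmanDiagram m,
      tlImmanant τ (jacobiTrudi m (column m) ⊥) = ribbonDet elemSymm c.blocks := by
  rw [jacobiTrudi_column_bot]
  cases m with
  | zero =>
    refine ⟨one 0, ?_⟩
    rw [tlImmanant_fin_zero, (Composition.blocks_eq_nil _).mpr rfl, ribbonDet_nil]
  | succ r =>
    obtain ⟨T, hT⟩ := exists_coarsen_one_eq_blocks c
    exact ⟨wordDiagram (sortedList T), by
      rw [replicate_succ_one_eq_cons_ofFn, tlImmanant_wordDiagram_ribbonMatrix elemSymm_zero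
        elemSymm_of_neg 1 (fun _ => one_pos), hT]⟩

theorem exists_tlImmanant_eq_ribbonDet_of_ne_zero {m : ℕ} {τ : KauffmanDiagram m}
    (h : tlImmanant τ (jacobiTrudi m (column m) ⊥) ≠ 0) :
    ∃ c : Composition m,
      tlImmanant τ (jacobiTrudi m (column m) ⊥) = ribbonDet elemSymm c.blocks := by
  rw [jacobiTrudi_column_bot] at h ⊢
  cases m with
  | zero =>
    refine ⟨default, ?_⟩
    rw [tlImmanant_fin_zero, (Composition.blocks_eq_nil _).mpr rfl, ribbonDet_nil]
  | succ r =>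
    rw [replicate_succ_one_eq_cons_ofFn] at h ⊢
    obtain ⟨T, rfl⟩ := exists_eq_wordDiagram_of_tlImmanant_ribbonMatrix_ne_zero elemSymm_zero
      elemSymm_of_neg (fun _ => one_pos) h
    obtain ⟨c, hc⟩ := exists_blocks_eq_coarsen_one T
    exact ⟨c, by rw [tlImmanant_wordDiagram_ribbonMatrix elemSymm_zero elemSymm_of_neg 1
      (fun _ => one_pos), hc]⟩

end TemperleyLiebImmanant

section JacobiTrudi

theorem det_add_of_column_eq {A : Type*} [CommRing A] (k c : ℕ) (M : ℕ → ℕ → A)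
    (hdiag : ∀ j < c, M j j = 1) (hlower : ∀ i j, j < c → j < i → M i j = 0) :
    (Matrix.of fun i j : Fin (k + c) => M i j).det =
      (Matrix.of fun i j : Fin k => M (i + c) (j + c)).det := by
  induction c generalizing M with
  | zero => rfl
  | succ c ih =>
    have hlower_zero (i : Fin (k + c)) : M (i + 1) 0 = 0 :=
      hlower _ _ c.succ_pos (i : ℕ).succ_pos
    calc (Matrix.of fun i j : Fin (k + c + 1) => M i j).det
        = (Matrix.of fun i j : Fin (k + c) => M (i + 1) (j + 1)).det := by
          rw [Matrix.det_succ_column_zero, Fin.sum_univ_succ]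
          simp [hdiag 0 c.succ_pos, hlower_zero, Matrix.submatrix]
      _ = _ := ih (fun i j => M (i + 1) (j + 1)) (fun j hj => hdiag (j + 1) (by omega))
          fun i j hj hij => hlower (i + 1) (j + 1) (by omega) (by omega)

theorem sum_range_map_sub_add {k : ℕ} {p q : ℕ → ℕ} (hqp : ∀ i < k, q i ≤ p i)
    (hp : ∀ i, i + 1 < k → p (i + 1) = q i + 1) {i : ℕ} (hi : i < k) :
    ((List.range i).map fun j => p j - q j).sum + p i = p 0 + i := by
  induction i with
  | zero => simp
  | succ i ih =>
    have := ih (by omega)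
    have := hqp i (by omega)
    have := hp i hi
    rw [List.sum_range_succ]
    omega

theorem det_eq_ribbonDet {A : Type*} [CommRing A] (e : ℤ → A) {k : ℕ} {p q : ℕ → ℕ}
    (hqp : ∀ i < k, q i ≤ p i) (hp : ∀ i, i + 1 < k → p (i + 1) = q i + 1) :
    (Matrix.of fun i j : Fin k => e ((p i : ℤ) - q j - (i : ℕ) + (j : ℕ))).det =
      ribbonDet e ((List.range k).map fun j => p j - q j) := by
  have hdet {l : List ℕ} (hl : l.length = k) : ribbonDet e l = (ribbonMatrix e k l).det := by
    subst hl
    rfl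
  rw [hdet (by simp)]
  congr 1
  ext i j
  have hi := sum_range_map_sub_add hqp hp i.isLt
  have hj := sum_range_map_sub_add hqp hp j.isLt
  have hqpj := hqp j j.isLt
  rw [Matrix.of_apply, ribbonMatrix_apply, ← List.map_take, ← List.map_take, List.take_range,
    List.take_range, min_eq_left (by omega), min_eq_left (by omega), List.sum_range_succ]
  congr 1
  omega

theorem skewSchur_eq_ribbonDet {l μ : YoungDiagram} {c k : ℕ} (hrow : l.rowLen 0 = k + c)
    (hempty : ∀ j < c, l.colLen j = μ.colLen j)
    (hle : ∀ j < k, μ.colLen (j + c) ≤ l.colLen (j + c))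
    (hsucc : ∀ j, j + 1 < k → l.colLen (j + 1 + c) = μ.colLen (j + c) + 1) :
    skewSchur l μ =
      ribbonDet elemSymm ((List.range k).map fun j => l.colLen (j + c) - μ.colLen (j + c)) := by
  rw [skewSchur, YoungDiagram.colLen_transpose, hrow, ← det_eq_ribbonDet elemSymm hle hsucc]
  simp only [jacobiTrudi, YoungDiagram.rowLen_transpose]
  rw [det_add_of_column_eq k c
    (fun i j => elemSymm ((l.colLen i : ℤ) - μ.colLen j - i + j))]
  · congr 1
    ext i j : 1
    simp only [Matrix.of_apply]
    congr 1
    omega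
  · intro j hj
    simp [hempty j hj, elemSymm_zero]
  · intro i j hj hji
    have := l.colLen_anti j i hji.le
    have := hempty j hj
    exact elemSymm_of_neg _ (by omega)

end JacobiTrudi

section Ribbon

variable {l μ : YoungDiagram} {i j k m : ℕ}

theorem lt_rowLen_iff_lt_colLen : j < l.rowLen i ↔ i < l.colLen j := by
  rw [← YoungDiagram.mem_iff_lt_rowLen, YoungDiagram.mem_iff_lt_colLen]

theorem mem_skewCells : (i, j) ∈ skewCells l μ ↔ μ.colLen j ≤ i ∧ i < l.colLen j := by
  rw [skewCells, Finset.mem_sdiff, YoungDiagram.mem_cells, YoungDiagram.mem_cells,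
    YoungDiagram.mem_iff_lt_colLen, YoungDiagram.mem_iff_lt_colLen, not_lt, and_comm]

theorem mem_skewCells_iff_rowLen : (i, j) ∈ skewCells l μ ↔ μ.rowLen i ≤ j ∧ j < l.rowLen i := by
  rw [mem_skewCells, lt_rowLen_iff_lt_colLen, ← not_lt, ← lt_rowLen_iff_lt_colLen, not_lt]

theorem card_skewCells (l μ : YoungDiagram) :
    (skewCells l μ).card = ∑ j ∈ Finset.range (l.rowLen 0), (l.colLen j - μ.colLen j) := by
  have hmaps : Set.MapsTo Prod.snd (skewCells l μ : Set (ℕ × ℕ)) (Finset.range (l.rowLen 0)) := by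
    rintro ⟨i, j⟩ h
    have := mem_skewCells.mp (Finset.mem_coe.mp h)
    simp only [Finset.coe_range, Set.mem_Iio, lt_rowLen_iff_lt_colLen]
    omega
  rw [Finset.card_eq_sum_card_fiberwise hmaps]
  refine Finset.sum_congr rfl fun j _ => ?_
  have hfiber : {x ∈ skewCells l μ | x.2 = j} =
      Finset.Ico (μ.colLen j) (l.colLen j) ×ˢ {j} := by
    ext ⟨i, j'⟩
    simp only [Finset.mem_filter, Finset.mem_product, Finset.mem_Ico, Finset.mem_singleton,
      mem_skewCells]
    exact and_congr_left fun h => by rw [h]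
  rw [hfiber, Finset.card_product, Nat.card_Ico, Finset.card_singleton, mul_one]

/-- Adjacency of cells within the skew shape `l / μ`; its reflexive transitive closure is the
connectedness relation of `IsRibbon`. -/
abbrev SkewAdj (l μ : YoungDiagram) (a b : ℕ × ℕ) : Prop :=
  a ∈ skewCells l μ ∧ b ∈ skewCells l μ ∧ CellAdj a b

theorem snd_le_of_reflTransGen_skewAdj (h : l.colLen (j + 1) ≤ μ.colLen j) {a b : ℕ × ℕ}
    (ha : a.2 ≤ j) (hab : Relation.ReflTransGen (SkewAdj l μ) a b) : b.2 ≤ j := by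
  induction hab with
  | refl => exact ha
  | @tail x y _ hxy ih =>
    obtain ⟨hx, hy, hadj⟩ := hxy
    by_contra! hcross
    obtain ⟨hfst, rfl, hsnd⟩ : x.1 = y.1 ∧ x.2 = j ∧ y.2 = x.2 + 1 := by
      unfold CellAdj at hadj
      omega
    have hx := (mem_skewCells.mp hx).1
    have hy := (mem_skewCells.mp hy).2
    rw [hsnd] at hy
    omega

namespace IsRibbon

theorem colLen_le (h : IsRibbon l μ) (j : ℕ) : μ.colLen j ≤ l.colLen j := by
  by_contra! hlt
  have hmem := h.le (YoungDiagram.mem_iff_lt_colLen.mpr hlt)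
  exact (YoungDiagram.mem_iff_lt_colLen.mp hmem).false

theorem colLen_succ_le (h : IsRibbon l μ) (hne : μ.colLen j < l.colLen j) :
    l.colLen (j + 1) ≤ μ.colLen j + 1 := by
  have hl := l.colLen_anti j (j + 1) j.le_succ
  have hμ := μ.colLen_anti j (j + 1) j.le_succ
  by_contra! hlt
  refine h.no_block (μ.colLen j) j ?_
  simp only [mem_skewCells]
  omega

theorem colLen_succ (h : IsRibbon l μ) (hrow : μ.rowLen 0 < l.rowLen 0) (hj : j + 1 < l.rowLen 0)
    (hne : μ.colLen j < l.colLen j) : l.colLen (j + 1) = μ.colLen j + 1 := by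
  refine le_antisymm (h.colLen_succ_le hne) ?_
  by_contra! hlt
  have htop : (μ.colLen j, j) ∈ skewCells l μ := mem_skewCells.mpr ⟨le_rfl, hne⟩
  have hlast : (0, l.rowLen 0 - 1) ∈ skewCells l μ := mem_skewCells_iff_rowLen.mpr (by omega)
  have : l.rowLen 0 - 1 ≤ j :=
    snd_le_of_reflTransGen_skewAdj (Nat.le_of_lt_succ hlt) le_rfl (h.connected _ htop _ hlast)
  omega

theorem colLen_lt_succ (h : IsRibbon l μ) (hrow : μ.rowLen 0 < l.rowLen 0)
    (hj : j + 1 < l.rowLen 0) (hne : μ.colLen j < l.colLen j) :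
    μ.colLen (j + 1) < l.colLen (j + 1) := by
  have := h.colLen_succ hrow hj hne
  have := μ.colLen_anti j (j + 1) j.le_succ
  omega

theorem exists_colLen_lt_iff (h : IsRibbon l μ)
    (hrow : 0 < l.rowLen 0 → μ.rowLen 0 < l.rowLen 0) :
    ∃ c ≤ l.rowLen 0, ∀ j < l.rowLen 0, μ.colLen j < l.colLen j ↔ c ≤ j := by
  classical
  have hex : ∃ c, l.rowLen 0 ≤ c ∨ μ.colLen c < l.colLen c := ⟨_, .inl le_rfl⟩
  refine ⟨Nat.find hex, Nat.find_min' hex (.inl le_rfl), fun j hj =>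
    ⟨fun hlt => Nat.find_min' hex (.inr hlt), fun hcj => ?_⟩⟩
  induction j, hcj using Nat.le_induction with
  | base => exact (Nat.find_spec hex).resolve_left hj.not_ge
  | succ j _ ih => exact h.colLen_lt_succ (hrow (by omega)) hj (ih (by omega))

end IsRibbon

theorem sum_map_range_colLen_sub {c : ℕ} (hrow : l.rowLen 0 = k + c)
    (hempty : ∀ j < c, l.colLen j = μ.colLen j) :
    ((List.range k).map fun j => l.colLen (j + c) - μ.colLen (j + c)).sum =
      (skewCells l μ).card := by
  rw [card_skewCells, hrow, add_comm, Finset.sum_range_add, Finset.sum_eq_zero, zero_add]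
  · simp only [add_comm c]
    rfl
  · intro j hj
    rw [hempty j (Finset.mem_range.mp hj), Nat.sub_self]

theorem exists_skewSchur_eq_ribbonDet {R : YoungDiagram × YoungDiagram} (hR : R ∈ ribbons m) :
    ∃ c : Composition m, skewSchur R.1 R.2 = ribbonDet elemSymm c.blocks := by
  obtain ⟨l, μ⟩ := R
  obtain ⟨hrib, hcard, hrow⟩ : IsRibbon l μ ∧ (skewCells l μ).card = m ∧
    ∀ i, μ.rowLen i < l.rowLen i ↔ i < l.colLen 0 := hR
  have hrow_zero (h : 0 < l.rowLen 0) : μ.rowLen 0 < l.rowLen 0 :=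
    (hrow 0).mpr (lt_rowLen_iff_lt_colLen.mp h)
  obtain ⟨c, hc, hlt⟩ := hrib.exists_colLen_lt_iff hrow_zero
  obtain ⟨k, hk⟩ := Nat.exists_eq_add_of_le' hc
  have hempty (j : ℕ) (hj : j < c) : l.colLen j = μ.colLen j :=
    (hrib.colLen_le j).antisymm' (not_lt.mp fun h => hj.not_ge ((hlt j (by omega)).mp h))
  have hnonempty (j : ℕ) (hj : j < k) : μ.colLen (j + c) < l.colLen (j + c) :=
    (hlt (j + c) (by omega)).mpr (by omega)
  refine ⟨⟨(List.range k).map fun j => l.colLen (j + c) - μ.colLen (j + c), ?_, ?_⟩, ?_⟩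
  · intro b hb
    obtain ⟨j, hj, rfl⟩ := List.mem_map.mp hb
    exact Nat.sub_pos_of_lt (hnonempty j (List.mem_range.mp hj))
  · rw [sum_map_range_colLen_sub hk hempty, hcard]
  · refine skewSchur_eq_ribbonDet hk hempty (fun j hj => (hnonempty j hj).le) fun j hj => ?_
    rw [add_right_comm]
    exact hrib.colLen_succ (hrow_zero (by omega)) (by omega) (hnonempty j (by omega))

/-- The column lengths of a ribbon whose columns are the first `k` ones, all of them nonempty. -/
structure HasRibbonColumns (l μ : YoungDiagram) (k : ℕ) : Prop where
  colLen_lt : ∀ j < k, μ.colLen j < l.colLen j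
  colLen_succ : ∀ j, j + 1 < k → l.colLen (j + 1) = μ.colLen j + 1
  outer_eq_zero : ∀ j, k ≤ j → l.colLen j = 0
  inner_eq_zero : ∀ j, k ≤ j + 1 → μ.colLen j = 0

instance (l μ : YoungDiagram) : Std.Symm (SkewAdj l μ) where
  symm := by
    rintro a b ⟨ha, hb, hab⟩
    refine ⟨hb, ha, ?_⟩
    unfold CellAdj at hab ⊢
    omega

theorem reflTransGen_skewAdj_column_top (h : (i, j) ∈ skewCells l μ) :
    Relation.ReflTransGen (SkewAdj l μ) (i, j) (μ.colLen j, j) := by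
  obtain ⟨hμ, hl⟩ := mem_skewCells.mp h
  induction i, hμ using Nat.le_induction with
  | base => exact .refl
  | succ i hμ ih =>
    have habove : (i, j) ∈ skewCells l μ := mem_skewCells.mpr ⟨hμ, by omega⟩
    exact .head ⟨h, habove, by simp [CellAdj]⟩ (ih habove (by omega))

namespace HasRibbonColumns

theorem colLen_lt_iff (h : HasRibbonColumns l μ k) : μ.colLen j < l.colLen j ↔ j < k := by
  refine ⟨fun hlt => ?_, h.colLen_lt j⟩
  by_contra! hkj
  rw [h.outer_eq_zero j hkj] at hlt
  exact not_lt_zero hlt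

theorem lt_of_mem (h : HasRibbonColumns l μ k) (hmem : (i, j) ∈ skewCells l μ) : j < k := by
  rw [mem_skewCells] at hmem
  exact h.colLen_lt_iff.mp (by omega)

theorem rowLen_zero (h : HasRibbonColumns l μ k) : l.rowLen 0 = k := by
  refine eq_of_forall_lt_iff fun j => ?_
  rw [lt_rowLen_iff_lt_colLen]
  have := h.colLen_lt j
  have := h.outer_eq_zero j
  omega

theorem reflTransGen_succ (h : HasRibbonColumns l μ k) (hj : j + 1 < k) :
    Relation.ReflTransGen (SkewAdj l μ) (μ.colLen j, j) (μ.colLen (j + 1), j + 1) := by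
  have htop : (μ.colLen j, j) ∈ skewCells l μ :=
    mem_skewCells.mpr ⟨le_rfl, h.colLen_lt j (by omega)⟩
  have hright : (μ.colLen j, j + 1) ∈ skewCells l μ :=
    mem_skewCells.mpr ⟨μ.colLen_anti j (j + 1) j.le_succ, by rw [h.colLen_succ j hj]; omega⟩
  exact .head ⟨htop, hright, by simp [CellAdj]⟩ (reflTransGen_skewAdj_column_top hright)

theorem reflTransGen_last (h : HasRibbonColumns l μ k) (hmem : (i, j) ∈ skewCells l μ) :
    Relation.ReflTransGen (SkewAdj l μ) (i, j) (0, k - 1) := by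
  have htops (n : ℕ) (hjn : j ≤ n) (hn : n < k) :
      Relation.ReflTransGen (SkewAdj l μ) (μ.colLen j, j) (μ.colLen n, n) := by
    induction n, hjn using Nat.le_induction with
    | base => exact .refl
    | succ n _ ih => exact (ih (by omega)).trans (h.reflTransGen_succ hn)
  have hj := h.lt_of_mem hmem
  have := (reflTransGen_skewAdj_column_top hmem).trans (htops (k - 1) (by omega) (by omega))
  rwa [h.inner_eq_zero (k - 1) (by omega)] at this

theorem isRibbon (h : HasRibbonColumns l μ k) : IsRibbon l μ where
  le := by
    rw [← YoungDiagram.cells_subset_iff]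
    rintro ⟨i, j⟩ hmem
    rw [YoungDiagram.mem_cells, YoungDiagram.mem_iff_lt_colLen] at hmem ⊢
    have := h.colLen_lt j
    have := h.inner_eq_zero j
    omega
  connected := by
    rintro ⟨i, j⟩ hc ⟨i', j'⟩ hd
    exact (h.reflTransGen_last hc).trans
      (Relation.ReflTransGen.stdSymm.symm _ _ (h.reflTransGen_last hd))
  no_block := by
    rintro i j ⟨hμ, -, -, hl⟩
    have := h.colLen_succ j (h.lt_of_mem hl)
    rw [mem_skewCells] at hμ hl
    omega

theorem rowLen_lt_iff (h : HasRibbonColumns l μ k) :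
    μ.rowLen i < l.rowLen i ↔ i < l.colLen 0 := by
  rw [← lt_rowLen_iff_lt_colLen]
  refine ⟨Nat.zero_lt_of_lt, fun hpos => ?_⟩
  obtain ⟨j, hj⟩ := Nat.exists_eq_add_one_of_ne_zero hpos.ne'
  have hin : i < l.colLen j := lt_rowLen_iff_lt_colLen.mp (by omega)
  have hout : l.colLen (j + 1) ≤ i := not_lt.mp fun hlt => by
    have := lt_rowLen_iff_lt_colLen.mpr hlt
    omega
  have hμ : μ.colLen j ≤ i := by
    have := h.colLen_succ j
    have := h.inner_eq_zero j
    omega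
  have := mem_skewCells_iff_rowLen.mp (mem_skewCells.mpr ⟨hμ, hin⟩)
  omega

theorem mem_ribbons (h : HasRibbonColumns l μ k) : (l, μ) ∈ ribbons (skewCells l μ).card :=
  ⟨h.isRibbon, rfl, fun _ => h.rowLen_lt_iff⟩

theorem skewSchur_eq_ribbonDet (h : HasRibbonColumns l μ k) :
    skewSchur l μ = ribbonDet elemSymm ((List.range k).map fun j => l.colLen j - μ.colLen j) :=
  TLImm.skewSchur_eq_ribbonDet (c := 0) h.rowLen_zero (by simp) (fun j hj => (h.colLen_lt j hj).le)
    h.colLen_succ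

theorem card_skewCells (h : HasRibbonColumns l μ k) :
    (skewCells l μ).card = ((List.range k).map fun j => l.colLen j - μ.colLen j).sum :=
  (sum_map_range_colLen_sub (c := 0) h.rowLen_zero (by simp)).symm

end HasRibbonColumns

/-- The Young diagram with column lengths `f j`, where `f` vanishes from `k` on. -/
def ofColLens (f : ℕ → ℕ) (hf : Antitone f) (k : ℕ) : YoungDiagram where
  cells := {c ∈ Finset.range (f 0) ×ˢ Finset.range k | c.1 < f c.2}
  isLowerSet := by
    rintro ⟨a, b⟩ ⟨c, d⟩ ⟨hca, hdb⟩ h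
    simp only [Finset.coe_filter, Finset.mem_product, Finset.mem_range, Set.mem_ofPred_eq] at h ⊢
    simp only at hca hdb
    have := hf hdb
    omega

theorem colLen_ofColLens {f : ℕ → ℕ} (hf : Antitone f) (hk : ∀ j, k ≤ j → f j = 0) (j : ℕ) :
    (ofColLens f hf k).colLen j = f j := by
  refine eq_of_forall_lt_iff fun i => ?_
  rw [← YoungDiagram.mem_iff_lt_colLen, ← YoungDiagram.mem_cells]
  simp only [ofColLens, Finset.mem_filter, Finset.mem_product, Finset.mem_range]
  have := hf (Nat.zero_le j)
  have := hk j
  omega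

/-- The total excess over `1` of the entries of `L` from position `j` on. In a ribbon with column
lengths `L` this is the number of empty cells above column `j - 1`, because consecutive columns
overlap in exactly one row. -/
def tailExcess (L : List ℕ) (j : ℕ) : ℕ :=
  ((L.drop j).map (· - 1)).sum

theorem tailExcess_eq_getElem_add {L : List ℕ} {j : ℕ} (hj : j < L.length) :
    tailExcess L j = L[j] - 1 + tailExcess L (j + 1) := by
  rw [tailExcess, List.drop_eq_getElem_cons hj, List.map_cons, List.sum_cons, tailExcess]

theorem tailExcess_of_length_le {L : List ℕ} (hj : L.length ≤ j) : tailExcess L j = 0 := by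
  rw [tailExcess, List.drop_of_length_le hj, List.map_nil, List.sum_nil]

theorem tailExcess_antitone (L : List ℕ) : Antitone (tailExcess L) := by
  refine antitone_nat_of_succ_le fun j => ?_
  rcases lt_or_ge j L.length with hj | hj
  · rw [tailExcess_eq_getElem_add hj]
    exact Nat.le_add_left _ _
  · rw [tailExcess_of_length_le (hj.trans j.le_succ)]
    exact Nat.zero_le _

theorem outerColLen_antitone (L : List ℕ) :
    Antitone fun j => if j < L.length then tailExcess L j + 1 else 0 := by
  intro i j hij
  have := tailExcess_antitone L hij
  dsimp only
  split_ifs <;> omega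

theorem exists_hasRibbonColumns {L : List ℕ} (hpos : ∀ a ∈ L, 0 < a) :
    ∃ l μ, HasRibbonColumns l μ L.length ∧
      (List.range L.length).map (fun j => l.colLen j - μ.colLen j) = L := by
  have hinner : Antitone fun j => tailExcess L (j + 1) := fun i j hij =>
    tailExcess_antitone L (Nat.succ_le_succ hij)
  have hl := colLen_ofColLens (k := L.length) (outerColLen_antitone L)
    fun j hj => if_neg hj.not_gt
  have hμ := colLen_ofColLens (k := L.length) hinner
    fun j hj => tailExcess_of_length_le (hj.trans j.le_succ)
  refine ⟨ofColLens _ (outerColLen_antitone L) L.length, ofColLens _ hinner L.length, ?_, ?_⟩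
  · constructor
    · intro j hj
      rw [hl, hμ, if_pos hj, tailExcess_eq_getElem_add hj]
      omega
    · intro j hj
      rw [hl, hμ, if_pos hj]
    · intro j hj
      rw [hl, if_neg hj.not_gt]
    · intro j hj
      rw [hμ, tailExcess_of_length_le hj]
  · refine List.ext_getElem (by simp) fun j _ hj => ?_
    have := hpos _ (L.getElem_mem hj)
    simp only [List.getElem_map, List.getElem_range, hl, hμ, if_pos hj,
      tailExcess_eq_getElem_add hj]
    omega

theorem exists_mem_ribbons_skewSchur_eq_ribbonDet (c : Composition m) :
    ∃ R ∈ ribbons m, (∀ j, R.2.colLen j < R.1.colLen j ↔ j < R.1.rowLen 0) ∧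
      skewSchur R.1 R.2 = ribbonDet elemSymm c.blocks := by
  obtain ⟨l, μ, h, hblocks⟩ := exists_hasRibbonColumns fun _ => c.blocks_pos
  have hcard : (skewCells l μ).card = m := by rw [h.card_skewCells, hblocks, c.blocks_sum]
  refine ⟨(l, μ), hcard ▸ h.mem_ribbons, fun j => ?_, ?_⟩
  · rw [h.rowLen_zero, h.colLen_lt_iff]
  · rw [h.skewSchur_eq_ribbonDet, hblocks]

end Ribbon

end TLImm

theorem mainTheorem7 (m : ℕ) :
    (∀ R ∈ TLImm.ribbons m, ∃ τ : TLImm.KauffmanDiagram m,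
      TLImm.skewSchur R.1 R.2 =
        TLImm.tlImmanant τ (TLImm.jacobiTrudi m (TLImm.column m) ⊥)) ∧
    (∀ τ : TLImm.KauffmanDiagram m,
      TLImm.tlImmanant τ (TLImm.jacobiTrudi m (TLImm.column m) ⊥) ≠ 0 →
        ∃ R ∈ TLImm.ribbons m,
          (∀ j, R.2.colLen j < R.1.colLen j ↔ j < R.1.rowLen 0) ∧
          TLImm.tlImmanant τ (TLImm.jacobiTrudi m (TLImm.column m) ⊥) =
            TLImm.skewSchur R.1 R.2) := by
  constructor
  · intro R hR
    obtain ⟨c, hskew⟩ := TLImm.exists_skewSchur_eq_ribbonDet hR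
    obtain ⟨τ, himm⟩ := TLImm.exists_tlImmanant_eq_ribbonDet c
    exact ⟨τ, hskew.trans himm.symm⟩
  · intro τ hτ
    obtain ⟨c, himm⟩ := TLImm.exists_tlImmanant_eq_ribbonDet_of_ne_zero hτ
    obtain ⟨R, hR, hcol, hskew⟩ := TLImm.exists_mem_ribbons_skewSchur_eq_ribbonDet c
    exact ⟨R, hR, hcol, himm.trans hskew.symm⟩
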